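/- Let $(\xi_i)_{i\in\mathbb Z}$ be a sequence of centered, square integrable, non essentially constant real random variables on a probability space $(\Omega,\mathcal A,\mathbb P)$. Let $k_0 \in \mathbb N$, let $(k_n)_{n\ge 1}$ be a nondecreasing sequence of positive integers with $k_n\to\infty$, and let $\{a_{n,i} : n\in\mathbb N,\ -k_n\le i\le k_n\}$ be a triangular array of real numbers with $\sum_{i=-k_n}^{k_n}a_{n,i}^2>0$ for all $n \in \mathbb N$. Put $$\Sigma_n=\sum_{i=-k_n}^{k_n}a_{n,i}\,\xi_i,\qquad \sigma_n^2=\operatorname{Var}(\Sigma_n),\quad \sigma_n\ge 0,\qquad \mathcal M_p=\sigma(\xi_j,\ j\le p)\quad(p\in\mathbb Z).$$ For an $\mathbb R^l$-valued square integrable random variable $X$ and a $\sigma$-algebra $\mathcal M\subseteq\mathcal A$ let $$\theta_2(\mathcal M,X)=\sup_f\ \bigl\|\mathbb E(f(X)\mid\mathcal M)-\mathbb E(f(X))\bigr\|_2,$$ the supremum being over all $f:\mathbb R^l\to\mathbb R$ with $|f(x)-f(y)|\le\sum_{i=1}^l|x_i-y_i|$ for all $x,y$. For $n\in\mathbb N$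 let $$\theta_2^{\xi}(n)=\sup_{k\ge1}\ \max_{1\le l\le k}\ \frac1l\,\sup\bigl\{\theta_2(\mathcal M_p,(\xi_{j_1},\dots,\xi_{j_l})) : p\in\mathbb Z,\ p+n\le j_1<\dots<j_l\bigr\}\in[0,\infty].$$ Assume: - $(A_1)$ (i) $\displaystyle\liminf_{n\to\infty}\frac{\sigma_n^2}{\sum_{i=-k_n}^{k_n}a_{n,i}^2}>0$, and (ii) $\displaystyle\lim_{n\to\infty}\sigma_n^{-1}\max_{-k_n\le i\le k_n}|a_{n,i}|=0$ (by (i), $\sigma_n>0$ for all large $n$); - $(A_2)$ the family $\{\xi_i^2\}_{i\in\mathbb Z}$ is uniformly integrable; - $(A_3)$ there is a non-negative function $g$ on $(0,\infty)$ such that $\theta_2^{\xi}(n)\le g(n)$ for all integers $n\ge1$, the function $x\mapsto x^{3/2}g(x)$ is non-increasing on $(0,\infty)$, and $\sum_{i=0}^{\infty}2^{3i/2}g(2^{i\varepsilon})<\infty$ for some $\varepsilon\in(0,1)$. Then $\Sigma_n/\sigma_n$ converges in distribution to $\mathcal N(0,1)$ as $n\to\infty$. -/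

import Mathlib

open MeasureTheory ProbabilityTheory Filter Topology
open scoped ENNReal NNReal

noncomputable section

namespace WeakDep

variable {Ω : Type*} [mΩ : MeasurableSpace Ω]

/-- `f : ℝ^m → ℝ` is Lipschitz with modulus at most `1` for the metric
`d₁(x, y) = ∑ i, |x i - y i|`. -/
def IsLip1 {m : ℕ} (f : (Fin m → ℝ) → ℝ) : Prop :=
  ∀ x y : Fin m → ℝ, |f x - f y| ≤ ∑ i, |x i - y i|

/-- The coefficient `θ₂(M, X)` of an `ℝ^m`-valued random variable `X` with respect to a
sub-σ-algebra `M`: the supremum of `‖E(f(X) | M) - E(f(X))‖₂` over the functions `f` that are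
`1`-Lipschitz for `d₁`. It is valued in `[0, ∞]`, so that the supremum is a genuine one. -/
def theta2Coeff (P : Measure Ω) (M : MeasurableSpace Ω) {m : ℕ} (X : Ω → Fin m → ℝ) : ℝ≥0∞ :=
  ⨆ (f : (Fin m → ℝ) → ℝ) (_ : IsLip1 f),
    eLpNorm (fun ω => (P[fun ω' => f (X ω') | M]) ω - ∫ ω', f (X ω') ∂P) 2 P

/-- `θ_{k,2}(n)` for a real sequence `ξ` and a sequence of σ-algebras `M`: the maximum over
`1 ≤ l ≤ k` of `1 / l` times the supremum of `θ₂(M p, (ξ_{j₁}, …, ξ_{j_l}))` over all `p` and all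
`p + n ≤ j₁ < ⋯ < j_l`. -/
def thetaK2 (P : Measure Ω) (M : ℤ → MeasurableSpace Ω) (ξ : ℤ → Ω → ℝ) (k n : ℕ) : ℝ≥0∞ :=
  ⨆ (l : ℕ) (_ : 1 ≤ l ∧ l ≤ k),
    (l : ℝ≥0∞)⁻¹ *
      ⨆ (p : ℤ) (j : Fin l → ℤ) (_ : StrictMono j ∧ ∀ i, p + (n : ℤ) ≤ j i),
        theta2Coeff P (M p) (fun ω i => ξ (j i) ω)

/-- `θ₂(n) = sup_{k ≥ 1} θ_{k,2}(n)`. -/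
def theta2 (P : Measure Ω) (M : ℤ → MeasurableSpace Ω) (ξ : ℤ → Ω → ℝ) (n : ℕ) : ℝ≥0∞ :=
  ⨆ (k : ℕ) (_ : 1 ≤ k), thetaK2 P M ξ k n

/-- The σ-algebra `σ(ξ_j, j ≤ i)`. -/
abbrev past (ξ : ℤ → Ω → ℝ) (i : ℤ) : MeasurableSpace Ω :=
  ⨆ (j : ℤ) (_ : j ≤ i), MeasurableSpace.comap (ξ j) inferInstance

/-- The row sum `∑_{i = -k_n}^{k_n} a_{n,i} ξ_i`. -/
def rowSum (k : ℕ → ℕ) (a : ℕ → ℤ → ℝ) (ξ : ℤ → Ω → ℝ) (n : ℕ) : Ω → ℝ :=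
  fun ω => ∑ i ∈ Finset.Icc (-(k n : ℤ)) (k n : ℤ), a n i * ξ i ω

/-- `σ_n`, the standard deviation of the row sum. -/
def rowSD (P : Measure Ω) (k : ℕ → ℕ) (a : ℕ → ℤ → ℝ) (ξ : ℤ → Ω → ℝ) (n : ℕ) : ℝ :=
  Real.sqrt (variance (rowSum k a ξ n) P)

/-- `max_{-k_n ≤ i ≤ k_n} |a_{n,i}|`. -/
def rowMax (k : ℕ → ℕ) (a : ℕ → ℤ → ℝ) (n : ℕ) : ℝ :=
  (Finset.Icc (-(k n : ℤ)) (k n : ℤ)).sup' ⟨0, by simp⟩ (fun i => |a n i|)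

end WeakDep

end

set_option linter.unusedSectionVars false

namespace WeakDep

/-! The proof shows that characteristic functions converge. It combines truncation with a
Lindeberg-type recursion whose errors are uniform in the length of the sum.

Bounded case. Let `Y` be centred, bounded by `1`, and such that single values and products of two
values decorrelate from the past at a summable rate `θ`. Put `e_k = exp (i ∑_{j<k} b_j Y_j)` and
`φ_k = E e_k`, and let `v_k` be the `k`-th increment of the variance of the partial sums. Expanding
`exp (i b_k Y_k)` to second order gives `φ_{k+1} = exp (-v_k/2) φ_k` up to a small error. The
first-order term `E (e_k Y_k)` is not zero. Telescoped over `i < k`, it produces the covariances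
`b_i b_k E (Y_i Y_k)` contained in `v_k`. At short lags this is a true cancellation, and at long
lags both quantities are small because `θ` is summable. The errors sum to a small multiple of `∑
b_i²`, and an integrating factor turns the recursion into `φ_N ≈ exp (-Var/2)`
(`norm_integral_expSum_sub_exp_le`).

Reduction. Truncation at level `T`, its residual, and products of suitably scaled truncations are
all Lipschitz, so `θ₂` controls them all. The truncated variables therefore satisfy the bounded case
(`causalWeakDep_scaledClip`). Covariances of the residuals are at most `r g(lag)`, where `r` is a
uniform `L²` bound made small by uniform integrability, so the residual sum is negligible in `L²`
(`integral_partialSum_residual_sq_le`). Summability of `g(n)` comes from `g(n) ≤ g(1) n^(-3/2)`.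
Assumption (A1) makes the normalised weights uniformly small with bounded sum of squares. -/

theorem sum_mul_abs_le (b w : ℕ → ℝ) (hw : ∀ d, 0 ≤ w d) (N : ℕ) :
    ∑ k ∈ Finset.range N, ∑ i ∈ Finset.range k, |b i| * |b k| * w (k - 1 - i)
      ≤ (∑ d ∈ Finset.range N, w d) * ∑ i ∈ Finset.range N, b i ^ 2 := by
  set W := ∑ d ∈ Finset.range N, w d
  -- Schur test: `|b_i| |b_k| ≤ (b_i² + b_k²) / 2`, and every row sum and every column sum of the
  -- lag kernel `w (k - 1 - i)` is at most `W`.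
  have h1 : ∀ k ∈ Finset.range N, ∑ i ∈ Finset.range k, w (k - 1 - i) ≤ W := by
    intro k hk
    rw [Finset.sum_range_reflect w k]
    exact Finset.sum_le_sum_of_subset_of_nonneg
      (Finset.range_mono (Finset.mem_range.1 hk).le) fun _ _ _ => hw _
  have h2 : ∀ i ∈ Finset.range N, ∑ k ∈ Finset.Ico (i + 1) N, w (k - 1 - i) ≤ W := by
    intro i hi
    rw [Finset.sum_Ico_eq_sum_range]
    have : ∀ d ∈ Finset.range (N - (i + 1)), w (i + 1 + d - 1 - i) = w d := by
      intro d _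
      congr 1
      omega
    rw [Finset.sum_congr rfl this]
    exact Finset.sum_le_sum_of_subset_of_nonneg
      (Finset.range_mono (Nat.sub_le _ _)) fun _ _ _ => hw _
  have h3 : ∑ k ∈ Finset.range N, ∑ i ∈ Finset.range k, b k ^ 2 * w (k - 1 - i)
      ≤ W * ∑ i ∈ Finset.range N, b i ^ 2 := by
    rw [Finset.mul_sum]
    refine Finset.sum_le_sum fun k hk => ?_
    rw [← Finset.mul_sum, mul_comm]
    exact mul_le_mul_of_nonneg_right (h1 k hk) (sq_nonneg _)
  have h4 : ∑ k ∈ Finset.range N, ∑ i ∈ Finset.range k, b i ^ 2 * w (k - 1 - i)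
      ≤ W * ∑ i ∈ Finset.range N, b i ^ 2 := by
    rw [Finset.sum_comm' (t' := Finset.range N) (s' := fun i => Finset.Ico (i + 1) N)
      (by intro x y; simp only [Finset.mem_range, Finset.mem_Ico]; omega), Finset.mul_sum]
    refine Finset.sum_le_sum fun i hi => ?_
    rw [← Finset.mul_sum, mul_comm]
    exact mul_le_mul_of_nonneg_right (h2 i hi) (sq_nonneg _)
  have h5 : ∀ k i, |b i| * |b k| * w (k - 1 - i)
      ≤ (b k ^ 2 * w (k - 1 - i) + b i ^ 2 * w (k - 1 - i)) / 2 := by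
    intro k i
    have : |b i| * |b k| ≤ (b k ^ 2 + b i ^ 2) / 2 := by
      nlinarith [sq_nonneg (|b i| - |b k|), sq_abs (b i), sq_abs (b k)]
    nlinarith [hw (k - 1 - i), mul_le_mul_of_nonneg_right this (hw (k - 1 - i))]
  calc _ ≤ ∑ k ∈ Finset.range N, ∑ i ∈ Finset.range k,
        (b k ^ 2 * w (k - 1 - i) + b i ^ 2 * w (k - 1 - i)) / 2 :=
        Finset.sum_le_sum fun k _ => Finset.sum_le_sum fun i _ => h5 k i
    _ ≤ _ := by
        simp only [← Finset.sum_div, Finset.sum_add_distrib]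
        linarith

/-! ### Taylor remainders of `exp (i x)` -/

theorem norm_exp_I_mul_taylor_two_le {x : ℝ} (hx : |x| ≤ 1) :
    ‖Complex.exp (Complex.I * x) - (1 + Complex.I * x - x ^ 2 / 2)‖ ≤ 3 * |x| ^ 3 := by
  have h := Complex.norm_exp_sub_sum_le_norm_mul_exp (Complex.I * x) 3
  have hn : ‖Complex.I * (x : ℂ)‖ = |x| := by simp
  rw [hn] at h
  have e : ∑ m ∈ Finset.range 3, (Complex.I * (x : ℂ)) ^ m / (m.factorial : ℂ)
      = 1 + Complex.I * x - x ^ 2 / 2 := by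
    simp [Finset.sum_range_succ, mul_pow]
    ring
  rw [e] at h
  refine h.trans ?_
  have : Real.exp |x| ≤ 3 := (Real.exp_le_exp.2 hx).trans Real.exp_one_lt_three.le
  nlinarith [pow_nonneg (abs_nonneg x) 3]

theorem norm_exp_I_mul_taylor_one_le {x : ℝ} (hx : |x| ≤ 1) :
    ‖Complex.exp (Complex.I * x) - (1 + Complex.I * x)‖ ≤ |x| ^ 2 := by
  have h := Complex.norm_exp_sub_one_sub_id_le (x := Complex.I * (x : ℂ)) (by simpa using hx)
  simpa [sub_sub] using h

/-! ### Bounded weakly dependent sequences and their exponential sums -/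

variable {Ω : Type*} [mΩ : MeasurableSpace Ω]

/-- A bounded centred sequence whose single values and products of two values decorrelate from the
past `F p`, at a rate `θ` in the size of the gap. -/
structure CausalWeakDep (P : Measure Ω) (F : ℕ → MeasurableSpace Ω) (Y : ℕ → Ω → ℝ)
    (θ : ℕ → ℝ) : Prop where
  mono : Monotone F
  le : ∀ n, F n ≤ mΩ
  meas : ∀ n, Measurable[F (n + 1)] (Y n)
  bdd : ∀ n ω, |Y n ω| ≤ 1
  cent : ∀ n, ∫ ω, Y n ω ∂P = 0
  nonneg : ∀ d, 0 ≤ θ d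
  single : ∀ (p k : ℕ) (Z : Ω → ℂ), p ≤ k → Measurable[F p] Z → (∀ ω, ‖Z ω‖ ≤ 1) →
    ‖∫ ω, Z ω * (Y k ω : ℂ) ∂P‖ ≤ θ (k - p)
  pair : ∀ (p i k : ℕ) (Z : Ω → ℂ), p ≤ i → i ≤ k → Measurable[F p] Z → (∀ ω, ‖Z ω‖ ≤ 1) →
    ‖∫ ω, Z ω * ((Y i ω * Y k ω - ∫ ω', Y i ω' * Y k ω' ∂P : ℝ) : ℂ) ∂P‖ ≤ θ (i - p)

/-- `∑_{i < n} b_i Y_i`. -/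
noncomputable def partialSum (b : ℕ → ℝ) (Y : ℕ → Ω → ℝ) (n : ℕ) (ω : Ω) : ℝ :=
  ∑ i ∈ Finset.range n, b i * Y i ω

/-- `exp (i ∑_{i < n} b_i Y_i)`. -/
noncomputable def expSum (b : ℕ → ℝ) (Y : ℕ → Ω → ℝ) (n : ℕ) (ω : Ω) : ℂ :=
  Complex.exp (Complex.I * (partialSum b Y n ω : ℝ))

/-- The increment of the variance of the partial sums. -/
noncomputable def varIncr (P : Measure Ω) (b : ℕ → ℝ) (Y : ℕ → Ω → ℝ) (k : ℕ) : ℝ :=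
  b k ^ 2 * (∫ ω, Y k ω * Y k ω ∂P)
    + 2 * ∑ i ∈ Finset.range k, b i * b k * ∫ ω, Y i ω * Y k ω ∂P

theorem norm_expSum (b : ℕ → ℝ) (Y : ℕ → Ω → ℝ) (n : ℕ) (ω : Ω) : ‖expSum b Y n ω‖ = 1 :=
  Complex.norm_exp_I_mul_ofReal _

theorem expSum_zero (b : ℕ → ℝ) (Y : ℕ → Ω → ℝ) (ω : Ω) : expSum b Y 0 ω = 1 := by
  simp [expSum, partialSum]

theorem expSum_succ (b : ℕ → ℝ) (Y : ℕ → Ω → ℝ) (n : ℕ) (ω : Ω) :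
    expSum b Y (n + 1) ω = expSum b Y n ω * Complex.exp (Complex.I * (b n * Y n ω : ℝ)) := by
  rw [expSum, expSum, ← Complex.exp_add, partialSum, partialSum, Finset.sum_range_succ]
  push_cast
  ring_nf

theorem integrable_of_norm_le {P : Measure Ω} [IsFiniteMeasure P] {E : Type*}
    [NormedAddCommGroup E] [MeasurableSpace E] [BorelSpace E] [SecondCountableTopology E]
    {f : Ω → E} (hf : Measurable f) {C : ℝ} (h : ∀ ω, ‖f ω‖ ≤ C) : Integrable f P :=
  .of_bound hf.aestronglyMeasurable C (.of_forall h)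

theorem norm_integral_le_of_forall {P : Measure Ω} [IsProbabilityMeasure P] {f : Ω → ℂ} {C : ℝ}
    (h : ∀ ω, ‖f ω‖ ≤ C) : ‖∫ ω, f ω ∂P‖ ≤ C := by
  simpa using norm_integral_le_of_norm_le_const (μ := P) (.of_forall h)

/-! ### Decorrelation estimates -/

namespace CausalWeakDep

variable {P : Measure Ω} [IsProbabilityMeasure P] {F : ℕ → MeasurableSpace Ω} {Y : ℕ → Ω → ℝ}
  {θ : ℕ → ℝ} (H : CausalWeakDep P F Y θ) (b : ℕ → ℝ)

include H

theorem measurable (n : ℕ) : Measurable (Y n) := (H.meas n).mono (H.le _) le_rfl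

theorem measurable_partialSum (n : ℕ) : Measurable[F n] (partialSum b Y n) := by
  unfold partialSum
  refine Finset.measurable_fun_sum _ fun i hi => ?_
  exact ((H.meas i).mono (H.mono (Finset.mem_range.1 hi)) le_rfl).const_mul _

theorem measurable_expSum (n : ℕ) : Measurable[F n] (expSum b Y n) := by
  unfold expSum
  exact Complex.measurable_exp.comp
    ((Complex.measurable_ofReal.comp (H.measurable_partialSum b n)).const_mul _)

theorem measurable_expSum' (n : ℕ) : Measurable (expSum b Y n) :=
  (H.measurable_expSum b n).mono (H.le _) le_rfl

theorem norm_expSum_sub_le {δ : ℝ} (hb : ∀ i, |b i| ≤ δ) {i k : ℕ} (hik : i ≤ k) (ω : Ω) :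
    ‖expSum b Y k ω - expSum b Y i ω‖ ≤ (k - i : ℕ) * δ := by
  induction k, hik using Nat.le_induction with
  | base => simp
  | succ k hk ih =>
    have h1 : ‖expSum b Y (k + 1) ω - expSum b Y k ω‖ ≤ δ := by
      rw [expSum_succ, ← mul_sub_one, norm_mul, norm_expSum, one_mul]
      refine Real.norm_exp_I_mul_ofReal_sub_one_le.trans ?_
      rw [Real.norm_eq_abs, abs_mul]
      nlinarith [H.bdd k ω, hb k, abs_nonneg (b k), abs_nonneg (Y k ω)]
    have := norm_sub_le_norm_sub_add_norm_sub (expSum b Y (k + 1) ω) (expSum b Y k ω)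
      (expSum b Y i ω)
    rw [Nat.sub_add_comm hk]
    push_cast
    linarith

theorem abs_mul_le_one (i k : ℕ) (ω : Ω) : |Y i ω * Y k ω| ≤ 1 := by
  rw [abs_mul]
  exact mul_le_one₀ (H.bdd i ω) (abs_nonneg _) (H.bdd k ω)

theorem integrable_mul (i k : ℕ) : Integrable (fun ω => Y i ω * Y k ω) P :=
  integrable_of_norm_le ((H.measurable i).mul (H.measurable k)) (H.abs_mul_le_one i k)

theorem abs_cov_le_one (i k : ℕ) : |∫ ω, Y i ω * Y k ω ∂P| ≤ 1 := by
  have := norm_integral_le_of_norm_le_const (μ := P) (C := 1)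
    (.of_forall (H.abs_mul_le_one i k) : ∀ᵐ ω ∂P, ‖Y i ω * Y k ω‖ ≤ 1)
  simpa using this

theorem abs_cov_le {i k : ℕ} (hik : i < k) : |∫ ω, Y i ω * Y k ω ∂P| ≤ θ (k - 1 - i) := by
  -- `Y i` is only `F (i + 1)`-measurable, so the available gap is `k - (i + 1)`.
  have h := H.single (i + 1) k (fun ω => (Y i ω : ℂ)) hik
    (Complex.measurable_ofReal.comp (H.meas i)) (fun ω => by simpa using H.bdd i ω)
  have e : ∫ ω, (Y i ω : ℂ) * (Y k ω : ℂ) ∂P = ((∫ ω, Y i ω * Y k ω ∂P : ℝ) : ℂ) := by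
    rw [← integral_complex_ofReal]
    simp
  rw [e, Complex.norm_real, Real.norm_eq_abs] at h
  rwa [show k - 1 - i = k - (i + 1) by omega]

/-- The exponential up to `i` has no gap before `Y_i Y_k`. Dropping its last `L` factors creates
one: the change costs at most `L δ` times the bound `2` on the centred product, and `pair` with gap
`L` handles the rest. -/
theorem norm_integral_expSum_mul_pair_le {δ : ℝ} (hb : ∀ i, |b i| ≤ δ) (L : ℕ) {i k : ℕ}
    (hik : i ≤ k) :
    ‖∫ ω, expSum b Y i ω * ((Y i ω * Y k ω - ∫ ω', Y i ω' * Y k ω' ∂P : ℝ) : ℂ) ∂P‖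
      ≤ 2 * L * δ + θ L := by
  have hδ : 0 ≤ δ := (abs_nonneg _).trans (hb 0)
  set c := ∫ ω', Y i ω' * Y k ω' ∂P
  have hW : ∀ ω, ‖((Y i ω * Y k ω - c : ℝ) : ℂ)‖ ≤ 2 := by
    intro ω
    rw [Complex.norm_real, Real.norm_eq_abs]
    have := abs_sub (Y i ω * Y k ω) c
    have h2 := H.abs_mul_le_one i k ω
    have h3 : |c| ≤ 1 := H.abs_cov_le_one i k
    linarith
  have hWm : Measurable fun ω => ((Y i ω * Y k ω - c : ℝ) : ℂ) :=
    Complex.measurable_ofReal.comp (((H.measurable i).mul (H.measurable k)).sub_const c)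
  have hint : ∀ j, Integrable (fun ω => expSum b Y j ω * ((Y i ω * Y k ω - c : ℝ) : ℂ)) P := by
    intro j
    refine integrable_of_norm_le ((H.measurable_expSum' b j).mul hWm) (C := 2) fun ω => ?_
    rw [norm_mul, norm_expSum, one_mul]
    exact hW ω
  have hsplit : ∫ ω, expSum b Y i ω * ((Y i ω * Y k ω - c : ℝ) : ℂ) ∂P
      = (∫ ω, (expSum b Y i ω - expSum b Y (i - L) ω) * ((Y i ω * Y k ω - c : ℝ) : ℂ) ∂P)
        + ∫ ω, expSum b Y (i - L) ω * ((Y i ω * Y k ω - c : ℝ) : ℂ) ∂P := by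
    simp only [sub_mul]
    rw [integral_sub (hint _) (hint _)]
    ring
  rw [hsplit]
  refine (norm_add_le _ _).trans (add_le_add ?_ ?_)
  · refine norm_integral_le_of_forall fun ω => ?_
    rw [norm_mul]
    have h1 := H.norm_expSum_sub_le b hb (Nat.sub_le i L) ω
    have h2 : ((i - (i - L) : ℕ) : ℝ) * δ ≤ L * δ := by
      gcongr
      omega
    nlinarith [hW ω, norm_nonneg (expSum b Y i ω - expSum b Y (i - L) ω),
      norm_nonneg ((Y i ω * Y k ω - c : ℝ) : ℂ)]
  · by_cases hL : L ≤ i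
    · have := H.pair (i - L) i k (expSum b Y (i - L)) (Nat.sub_le _ _) hik
        (H.measurable_expSum b _) (fun ω => (norm_expSum b Y _ ω).le)
      rwa [Nat.sub_sub_self hL] at this
    · rw [Nat.sub_eq_zero_of_le (by omega : i ≤ L)]
      simp only [expSum_zero, one_mul]
      rw [integral_complex_ofReal, integral_sub (H.integrable_mul i k) (integrable_const _)]
      simp [c, H.nonneg]

theorem norm_integral_expSum_succ_sub_le {i k : ℕ} (hik : i < k) :
    ‖∫ ω, (expSum b Y (i + 1) ω - expSum b Y i ω) * (Y k ω : ℂ) ∂P‖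
      ≤ |b i| * θ (k - 1 - i) := by
  by_cases h0 : b i = 0
  · simp [expSum_succ, h0]
  have h0' : (b i : ℂ) ≠ 0 := by exact_mod_cast h0
  -- Dividing by `b i` gives a test variable bounded by `1`, so the estimate keeps the factor `|b
  -- i|`.
  have h := H.single (i + 1) k
    (fun ω => (expSum b Y (i + 1) ω - expSum b Y i ω) / (b i : ℂ)) hik
    (((H.measurable_expSum b (i + 1)).sub
      ((H.measurable_expSum b i).mono (H.mono i.le_succ) le_rfl)).div_const _) (fun ω => by
      rw [norm_div, expSum_succ, ← mul_sub_one, norm_mul, norm_expSum, one_mul,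
        Complex.norm_real, Real.norm_eq_abs, div_le_one (abs_pos.2 h0)]
      refine Real.norm_exp_I_mul_ofReal_sub_one_le.trans ?_
      rw [Real.norm_eq_abs, abs_mul]
      nlinarith [H.bdd i ω, abs_nonneg (b i)])
  have e : ∫ ω, (expSum b Y (i + 1) ω - expSum b Y i ω) * (Y k ω : ℂ) ∂P
      = (b i : ℂ) * ∫ ω, (expSum b Y (i + 1) ω - expSum b Y i ω) / (b i : ℂ) * (Y k ω : ℂ) ∂P := by
    rw [← integral_const_mul]
    congr 1
    ext ω
    field_simp
  rw [e, norm_mul, Complex.norm_real, Real.norm_eq_abs]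
  rw [show k - 1 - i = k - (i + 1) by omega]
  gcongr

/-- At long lags no cancellation is needed: the two terms are bounded separately, each by `θ` of the
lag. -/
theorem norm_cross_term_le_far {i k : ℕ} (hik : i < k) :
    ‖Complex.I * b k * ∫ ω, (expSum b Y (i + 1) ω - expSum b Y i ω) * (Y k ω : ℂ) ∂P
        + (b i * b k * (∫ ω, Y i ω * Y k ω ∂P) : ℝ) * ∫ ω, expSum b Y k ω ∂P‖
      ≤ |b i| * |b k| * (2 * θ (k - 1 - i)) := by
  have h1 := H.norm_integral_expSum_succ_sub_le b hik
  have h2 := H.abs_cov_le hik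
  have h3 : ‖∫ ω, expSum b Y k ω ∂P‖ ≤ 1 :=
    norm_integral_le_of_forall fun ω => (norm_expSum b Y k ω).le
  refine (norm_add_le _ _).trans ?_
  rw [norm_mul, norm_mul, norm_mul, Complex.norm_I, one_mul, Complex.norm_real, Complex.norm_real,
    Real.norm_eq_abs, Real.norm_eq_abs, abs_mul, abs_mul]
  have h4 := mul_le_mul_of_nonneg_left h1 (abs_nonneg (b k))
  have h5 : |b i| * |b k| * |∫ ω, Y i ω * Y k ω ∂P| * ‖∫ ω, expSum b Y k ω ∂P‖
      ≤ |b i| * |b k| * θ (k - 1 - i) * 1 := by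
    gcongr
    exact mul_nonneg (by positivity) (H.nonneg _)
  linarith

/-- At short lags the leading parts cancel: the increment of the exponential is close to `i b_i e_i
Y_i`, and `i² = -1` gives `-b_i b_k E (Y_i Y_k) φ_k`. The three errors are the Taylor remainder
(`δ`), the decorrelation of `Y_i Y_k` from `e_i` (`2 L δ + θ L`), and the replacement of `e_i` by
`e_k` (`m δ`). -/
theorem norm_cross_term_le_near {δ : ℝ} (hb : ∀ i, |b i| ≤ δ) (hδ1 : δ ≤ 1) (L m : ℕ) {i k : ℕ}
    (hik : i < k) (hm : k ≤ i + m) :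
    ‖Complex.I * b k * ∫ ω, (expSum b Y (i + 1) ω - expSum b Y i ω) * (Y k ω : ℂ) ∂P
        + (b i * b k * (∫ ω, Y i ω * Y k ω ∂P) : ℝ) * ∫ ω, expSum b Y k ω ∂P‖
      ≤ |b i| * |b k| * (δ + (2 * L * δ + θ L) + m * δ) := by
  have hδ : 0 ≤ δ := (abs_nonneg _).trans (hb 0)
  set c := ∫ ω, Y i ω * Y k ω ∂P with hc
  have hYk : ∀ ω, ‖(Y k ω : ℂ)‖ ≤ 1 := fun ω => by simpa using H.bdd k ω
  have hYi : ∀ ω, ‖(Y i ω : ℂ)‖ ≤ 1 := fun ω => by simpa using H.bdd i ω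
  have hmY : ∀ j, Measurable fun ω => (Y j ω : ℂ) :=
    fun j => Complex.measurable_ofReal.comp (H.measurable j)
  have hme := H.measurable_expSum' b
  have hie : ∀ j, Integrable (expSum b Y j) P :=
    fun j => integrable_of_norm_le (hme j) fun ω => (norm_expSum b Y j ω).le
  have hi1 : Integrable (fun ω => (expSum b Y (i + 1) ω - expSum b Y i ω
      - Complex.I * b i * (expSum b Y i ω * Y i ω)) * (Y k ω : ℂ)) P := by
    refine integrable_of_norm_le (C := 2 + |b i|) ((((hme _).sub (hme _)).sub
      (((hme i).mul (hmY i)).const_mul _)).mul (hmY k)) fun ω => ?_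
    rw [norm_mul]
    refine (mul_le_of_le_one_right (norm_nonneg _) (hYk ω)).trans ?_
    refine (norm_sub_le _ _).trans (add_le_add ((norm_sub_le _ _).trans ?_) ?_)
    · rw [norm_expSum, norm_expSum]; norm_num
    · rw [norm_mul, norm_mul, norm_mul, norm_expSum, Complex.norm_I, Complex.norm_real,
        Real.norm_eq_abs, one_mul, one_mul]
      exact mul_le_of_le_one_right (abs_nonneg _) (hYi ω)
  have hi2 : Integrable (fun ω => expSum b Y i ω * ((Y i ω * Y k ω - c : ℝ) : ℂ)) P := by
    refine integrable_of_norm_le (C := 1 + |c|) ((hme i).mul (Complex.measurable_ofReal.comp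
      (((H.measurable i).mul (H.measurable k)).sub_const c))) fun ω => ?_
    rw [norm_mul, norm_expSum, one_mul, Complex.norm_real, Real.norm_eq_abs]
    exact (abs_sub _ _).trans (add_le_add_left (H.abs_mul_le_one i k ω) _)
  have key : Complex.I * b k * ∫ ω, (expSum b Y (i + 1) ω - expSum b Y i ω) * (Y k ω : ℂ) ∂P
        + (b i * b k * c : ℝ) * ∫ ω, expSum b Y k ω ∂P
      = Complex.I * b k * (∫ ω, (expSum b Y (i + 1) ω - expSum b Y i ω
          - Complex.I * b i * (expSum b Y i ω * Y i ω)) * (Y k ω : ℂ) ∂P)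
        - (b i * b k : ℝ) * (∫ ω, expSum b Y i ω * ((Y i ω * Y k ω - c : ℝ) : ℂ) ∂P)
        + (b i * b k * c : ℝ) * ∫ ω, (expSum b Y k ω - expSum b Y i ω) ∂P := by
    have e1 : ∫ ω, (expSum b Y (i + 1) ω - expSum b Y i ω) * (Y k ω : ℂ) ∂P
        = ∫ ω, ((expSum b Y (i + 1) ω - expSum b Y i ω
          - Complex.I * b i * (expSum b Y i ω * Y i ω)) * (Y k ω : ℂ)
          + Complex.I * b i * (expSum b Y i ω * ((Y i ω * Y k ω - c : ℝ) : ℂ))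
          + Complex.I * b i * c * expSum b Y i ω) ∂P := by
      congr 1
      ext ω
      push_cast
      ring
    have e2 := integral_add (hi1.add (hi2.const_mul (Complex.I * b i)))
      ((hie i).const_mul (Complex.I * b i * c))
    simp only [Pi.add_apply] at e2
    rw [e1, e2, integral_add hi1 (hi2.const_mul _), integral_const_mul, integral_const_mul,
      integral_sub (hie k) (hie i)]
    push_cast
    linear_combination (b i * b k * (∫ ω, expSum b Y i ω * ((Y i ω : ℂ) * (Y k ω) - c) ∂P)
      + b i * b k * c * ∫ ω, expSum b Y i ω ∂P) * Complex.I_sq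
  have hA : ‖∫ ω, (expSum b Y (i + 1) ω - expSum b Y i ω
          - Complex.I * b i * (expSum b Y i ω * Y i ω)) * (Y k ω : ℂ) ∂P‖ ≤ |b i| * δ := by
    refine norm_integral_le_of_forall fun ω => ?_
    rw [norm_mul]
    refine (mul_le_of_le_one_right (norm_nonneg _) (hYk ω)).trans ?_
    have e2 : expSum b Y (i + 1) ω - expSum b Y i ω - Complex.I * b i * (expSum b Y i ω * Y i ω)
        = expSum b Y i ω * (Complex.exp (Complex.I * (b i * Y i ω : ℝ))
          - (1 + Complex.I * (b i * Y i ω : ℝ))) := by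
      rw [expSum_succ]
      push_cast
      ring
    have hx : |b i * Y i ω| ≤ |b i| := by
      rw [abs_mul]
      exact mul_le_of_le_one_right (abs_nonneg _) (H.bdd i ω)
    rw [e2, norm_mul, norm_expSum, one_mul]
    refine (norm_exp_I_mul_taylor_one_le (hx.trans ((hb i).trans hδ1))).trans ?_
    nlinarith [hb i, abs_nonneg (b i), abs_nonneg (b i * Y i ω)]
  have hB := H.norm_integral_expSum_mul_pair_le b hb L hik.le
  have hC : ‖∫ ω, (expSum b Y k ω - expSum b Y i ω) ∂P‖ ≤ m * δ := by
    refine norm_integral_le_of_forall fun ω => (H.norm_expSum_sub_le b hb hik.le ω).trans ?_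
    gcongr
    omega
  rw [key]
  refine (norm_add_le _ _).trans ?_
  refine (add_le_add_left (norm_sub_le _ _) _).trans ?_
  simp only [norm_mul, Complex.norm_I, one_mul, Complex.norm_real, Real.norm_eq_abs]
  have h1 := mul_le_mul_of_nonneg_left hA (abs_nonneg (b k))
  have h2 := mul_le_mul_of_nonneg_left hB (mul_nonneg (abs_nonneg (b i)) (abs_nonneg (b k)))
  have h3 : |b i| * |b k| * |c| * ‖∫ ω, (expSum b Y k ω - expSum b Y i ω) ∂P‖
      ≤ |b i| * |b k| * 1 * (m * δ) := by
    gcongr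
    exact H.abs_cov_le_one i k
  linarith

end CausalWeakDep

/-! ### Variance of weighted sums -/

/-- It serves twice: with `w = θ` for the bounded sequence, and with `w` proportional to `r` for the
truncation residuals. -/
theorem sum_abs_varIncr_le {P : Measure Ω} {Y : ℕ → Ω → ℝ} {w : ℕ → ℝ} {A W : ℝ}
    (hw : ∀ d, 0 ≤ w d) (hA : ∀ k, |∫ ω, Y k ω * Y k ω ∂P| ≤ A)
    (hcov : ∀ i k, i < k → |∫ ω, Y i ω * Y k ω ∂P| ≤ w (k - 1 - i))
    (hW : ∀ n, ∑ d ∈ Finset.range n, w d ≤ W) (b : ℕ → ℝ) (N : ℕ) :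
    ∑ k ∈ Finset.range N, |varIncr P b Y k| ≤ (A + 2 * W) * ∑ i ∈ Finset.range N, b i ^ 2 := by
  have h : ∀ k ∈ Finset.range N, |varIncr P b Y k|
      ≤ A * b k ^ 2 + 2 * ∑ i ∈ Finset.range k, |b i| * |b k| * w (k - 1 - i) := fun k _ => by
    refine (abs_add_le _ _).trans (add_le_add ?_ ?_)
    · rw [abs_mul, abs_of_nonneg (sq_nonneg (b k)), mul_comm]
      exact mul_le_mul_of_nonneg_right (hA k) (sq_nonneg _)
    · rw [abs_mul, abs_two]
      gcongr
      refine (Finset.abs_sum_le_sum_abs _ _).trans (Finset.sum_le_sum fun i hi => ?_)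
      rw [abs_mul, abs_mul]
      gcongr
      exact hcov i k (Finset.mem_range.1 hi)
  refine (Finset.sum_le_sum h).trans ?_
  rw [Finset.sum_add_distrib, ← Finset.mul_sum, ← Finset.mul_sum]
  have h2 := sum_mul_abs_le b w hw N
  have h3 : (∑ d ∈ Finset.range N, w d) * ∑ i ∈ Finset.range N, b i ^ 2
      ≤ W * ∑ i ∈ Finset.range N, b i ^ 2 :=
    mul_le_mul_of_nonneg_right (hW N) (Finset.sum_nonneg fun _ _ => sq_nonneg _)
  linarith

theorem integral_partialSum_sq {P : Measure Ω} {Y : ℕ → Ω → ℝ}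
    (hY : ∀ i k, Integrable (fun ω => Y i ω * Y k ω) P) (b : ℕ → ℝ) (n : ℕ) :
    ∫ ω, partialSum b Y n ω ^ 2 ∂P = ∑ k ∈ Finset.range n, varIncr P b Y k := by
  induction n with
  | zero => simp [partialSum]
  | succ n ih =>
    have e : ∀ ω, partialSum b Y (n + 1) ω ^ 2 = partialSum b Y n ω ^ 2
        + (b n ^ 2 * (Y n ω * Y n ω)
          + 2 * ∑ i ∈ Finset.range n, b i * b n * (Y i ω * Y n ω)) := fun ω => by
      have : ∑ i ∈ Finset.range n, b i * b n * (Y i ω * Y n ω)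
          = partialSum b Y n ω * (b n * Y n ω) := by
        rw [partialSum, Finset.sum_mul]
        exact Finset.sum_congr rfl fun i _ => by ring
      rw [this, partialSum, partialSum, Finset.sum_range_succ]
      ring
    have hi : ∀ i, Integrable (fun ω => b i * b n * (Y i ω * Y n ω)) P :=
      fun i => (hY i n).const_mul _
    have hsq : Integrable (fun ω => partialSum b Y n ω ^ 2) P := by
      have : ∀ ω, partialSum b Y n ω ^ 2
          = ∑ i ∈ Finset.range n, ∑ j ∈ Finset.range n, b i * b j * (Y i ω * Y j ω) := fun ω => by
        rw [partialSum, sq, Finset.sum_mul_sum]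
        exact Finset.sum_congr rfl fun i _ => Finset.sum_congr rfl fun j _ => by ring
      simp_rw [this]
      exact integrable_finsetSum _ fun i _ => integrable_finsetSum _ fun j _ =>
        (hY i j).const_mul _
    have hs : Integrable (fun ω => ∑ i ∈ Finset.range n, b i * b n * (Y i ω * Y n ω)) P :=
      integrable_finsetSum _ fun i _ => hi i
    simp_rw [e]
    have e2 := integral_add hsq (((hY n n).const_mul (b n ^ 2)).add (hs.const_mul 2))
    simp only [Pi.add_apply] at e2
    rw [e2, ih, integral_add ((hY n n).const_mul _) (hs.const_mul _), integral_const_mul,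
      integral_const_mul, integral_finsetSum _ fun i _ => hi i, Finset.sum_range_succ, varIncr]
    simp_rw [integral_const_mul]

/-! ### Recursion for the characteristic function -/

namespace CausalWeakDep

variable {P : Measure Ω} [IsProbabilityMeasure P] {F : ℕ → MeasurableSpace Ω} {Y : ℕ → Ω → ℝ}
  {θ : ℕ → ℝ} (H : CausalWeakDep P F Y θ) (b : ℕ → ℝ)

include H

/-- Telescoping from `e_0 = 1`, whose term vanishes because `Y k` is centred. -/
theorem integral_expSum_mul_eq_sum (k : ℕ) :
    ∫ ω, expSum b Y k ω * (Y k ω : ℂ) ∂P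
      = ∑ i ∈ Finset.range k,
        ∫ ω, (expSum b Y (i + 1) ω - expSum b Y i ω) * (Y k ω : ℂ) ∂P := by
  have hint : ∀ j, Integrable (fun ω => expSum b Y j ω * (Y k ω : ℂ)) P := fun j => by
    refine integrable_of_norm_le (C := 1) ((H.measurable_expSum' b j).mul
      (Complex.measurable_ofReal.comp (H.measurable k))) fun ω => ?_
    rw [norm_mul, norm_expSum, one_mul]
    simpa using H.bdd k ω
  have h0 : ∫ ω, expSum b Y 0 ω * (Y k ω : ℂ) ∂P = 0 := by
    simp only [expSum_zero, one_mul]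
    rw [integral_complex_ofReal, H.cent, Complex.ofReal_zero]
  simp only [sub_mul]
  simp_rw [fun i => integral_sub (hint (i + 1)) (hint i)]
  rw [Finset.sum_range_sub (fun j => ∫ ω, expSum b Y j ω * (Y k ω : ℂ) ∂P), h0, sub_zero]

/-- The factor `|b k|` is kept so that the square of the increment, which is the error in
linearising `exp (-v/2)`, is a small multiple of `b k ^ 2`. -/
theorem abs_varIncr_le {Θ : ℝ} (hΘ : ∀ n, ∑ d ∈ Finset.range n, θ d ≤ Θ) {δ : ℝ}
    (hb : ∀ i, |b i| ≤ δ) (k : ℕ) : |varIncr P b Y k| ≤ |b k| * (δ * (1 + 2 * Θ)) := by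
  have hδ : 0 ≤ δ := (abs_nonneg _).trans (hb 0)
  have h1 : |b k ^ 2 * ∫ ω, Y k ω * Y k ω ∂P| ≤ |b k| * δ := by
    rw [abs_mul, abs_pow]
    have := H.abs_cov_le_one k k
    nlinarith [hb k, abs_nonneg (b k), mul_le_mul_of_nonneg_left this (sq_nonneg |b k|)]
  have h2 : |∑ i ∈ Finset.range k, b i * b k * ∫ ω, Y i ω * Y k ω ∂P| ≤ |b k| * (δ * Θ) := by
    refine (Finset.abs_sum_le_sum_abs _ _).trans ?_
    have : ∀ i ∈ Finset.range k, |b i * b k * ∫ ω, Y i ω * Y k ω ∂P|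
        ≤ |b k| * δ * θ (k - 1 - i) := fun i hi => by
      rw [abs_mul, abs_mul, mul_comm |b i|]
      gcongr
      · exact hb i
      · exact H.abs_cov_le (Finset.mem_range.1 hi)
    refine (Finset.sum_le_sum this).trans ?_
    rw [← Finset.mul_sum, Finset.sum_range_reflect θ k, ← mul_assoc]
    gcongr
    exact hΘ k
  refine (abs_add_le _ _).trans ?_
  rw [abs_mul 2, abs_two]
  linarith

/-- One step of the recursion. The sum over `i` collects the cross terms, near or far according to
the cutoff `m`. The terms in `b k ^ 2` come from decorrelating `Y_k²`, from the cubic Taylor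
remainder, and from linearising `exp (-v/2)`. -/
theorem norm_integral_expSum_succ_sub_exp_mul_le {Θ : ℝ}
    (hΘ : ∀ n, ∑ d ∈ Finset.range n, θ d ≤ Θ) {δ : ℝ} (hb : ∀ i, |b i| ≤ δ)
    (hδ : δ * (1 + 2 * Θ) ≤ 1) (L m k : ℕ) :
    ‖∫ ω, expSum b Y (k + 1) ω ∂P
        - (Real.exp (-(varIncr P b Y k / 2)) : ℂ) * ∫ ω, expSum b Y k ω ∂P‖
      ≤ ∑ i ∈ Finset.range k, |b i| * |b k|
          * (if k - 1 - i < m then δ + (2 * L * δ + θ L) + m * δ else 2 * θ (k - 1 - i))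
        + b k ^ 2 * ((2 * L * δ + θ L) + 3 * δ + (δ * (1 + 2 * Θ)) ^ 2) := by
  have hδ0 : 0 ≤ δ := (abs_nonneg _).trans (hb 0)
  have hΘ0 : 0 ≤ Θ := by simpa using hΘ 0
  have hδ1 : δ ≤ 1 := by nlinarith
  set v := varIncr P b Y k with hv
  set c := fun i => ∫ ω, Y i ω * Y k ω ∂P with hc
  have hmY : Measurable fun ω => (Y k ω : ℂ) := Complex.measurable_ofReal.comp (H.measurable k)
  have hYk : ∀ ω, ‖(Y k ω : ℂ)‖ ≤ 1 := fun ω => by simpa using H.bdd k ω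
  have hme := H.measurable_expSum' b k
  have hie : ∀ j, Integrable (expSum b Y j) P :=
    fun j => integrable_of_norm_le (H.measurable_expSum' b j) fun ω => (norm_expSum b Y j ω).le
  have hx : ∀ ω, |b k * Y k ω| ≤ |b k| := fun ω => by
    rw [abs_mul]
    exact mul_le_of_le_one_right (abs_nonneg _) (H.bdd k ω)
  set R : Ω → ℂ := fun ω => Complex.exp (Complex.I * (b k * Y k ω : ℝ))
    - (1 + Complex.I * (b k * Y k ω : ℝ) - ((b k * Y k ω : ℝ) : ℂ) ^ 2 / 2) with hR
  have hRb : ∀ ω, ‖R ω‖ ≤ 3 * δ * b k ^ 2 := fun ω => by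
    refine (norm_exp_I_mul_taylor_two_le ((hx ω).trans ((hb k).trans hδ1))).trans ?_
    have h1 : |b k * Y k ω| ^ 3 ≤ |b k| ^ 3 := pow_le_pow_left₀ (abs_nonneg _) (hx ω) 3
    have h2 : |b k| ^ 3 ≤ δ * b k ^ 2 := by
      rw [← sq_abs (b k), pow_succ, mul_comm]
      exact mul_le_mul_of_nonneg_right (hb k) (sq_nonneg _)
    linarith
  have hRm : Measurable R := by
    have : Measurable fun ω => ((b k * Y k ω : ℝ) : ℂ) :=
      Complex.measurable_ofReal.comp ((H.measurable k).const_mul _)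
    fun_prop
  have hi1 : Integrable (fun ω => expSum b Y k ω * R ω) P := by
    refine integrable_of_norm_le (hme.mul hRm) (C := 3 * δ * b k ^ 2) fun ω => ?_
    rw [norm_mul, norm_expSum, one_mul]
    exact hRb ω
  have hi2 : Integrable (fun ω => expSum b Y k ω * (Y k ω : ℂ)) P := by
    refine integrable_of_norm_le (hme.mul hmY) (C := 1) fun ω => ?_
    rw [norm_mul, norm_expSum, one_mul]
    exact hYk ω
  have hi3 : Integrable (fun ω => expSum b Y k ω * ((Y k ω * Y k ω - c k : ℝ) : ℂ)) P := by
    refine integrable_of_norm_le (C := 1 + |c k|) (hme.mul (Complex.measurable_ofReal.comp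
      (((H.measurable k).mul (H.measurable k)).sub_const (c k)))) fun ω => ?_
    rw [norm_mul, norm_expSum, one_mul, Complex.norm_real, Real.norm_eq_abs]
    exact (abs_sub _ _).trans (add_le_add_left (H.abs_mul_le_one k k ω) _)
  have e1 : ∫ ω, expSum b Y (k + 1) ω ∂P
      = ∫ ω, expSum b Y k ω * R ω ∂P + Complex.I * b k * ∫ ω, expSum b Y k ω * (Y k ω : ℂ) ∂P
        - (b k ^ 2 / 2 : ℝ) * (∫ ω, expSum b Y k ω * ((Y k ω * Y k ω - c k : ℝ) : ℂ) ∂P)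
        + (1 - b k ^ 2 / 2 * c k : ℝ) * ∫ ω, expSum b Y k ω ∂P := by
    have : ∀ ω, expSum b Y (k + 1) ω = expSum b Y k ω * R ω
        + Complex.I * b k * (expSum b Y k ω * (Y k ω : ℂ))
        - (b k ^ 2 / 2 : ℝ) * (expSum b Y k ω * ((Y k ω * Y k ω - c k : ℝ) : ℂ))
        + (1 - b k ^ 2 / 2 * c k : ℝ) * expSum b Y k ω := fun ω => by
      rw [expSum_succ, hR]
      push_cast
      ring
    simp_rw [this]
    have a1 := integral_add ((hi1.add (hi2.const_mul (Complex.I * b k))).sub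
      (hi3.const_mul ((b k ^ 2 / 2 : ℝ) : ℂ)))
      ((hie k).const_mul ((1 - b k ^ 2 / 2 * c k : ℝ) : ℂ))
    have a2 := integral_sub (hi1.add (hi2.const_mul (Complex.I * b k)))
      (hi3.const_mul ((b k ^ 2 / 2 : ℝ) : ℂ))
    simp only [Pi.add_apply, Pi.sub_apply] at a1 a2
    rw [a1, a2, integral_add hi1 (hi2.const_mul _), integral_const_mul, integral_const_mul,
      integral_const_mul]
  set T : ℕ → ℂ := fun i =>
    Complex.I * b k * ∫ ω, (expSum b Y (i + 1) ω - expSum b Y i ω) * (Y k ω : ℂ) ∂P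
        + (b i * b k * c i : ℝ) * ∫ ω, expSum b Y k ω ∂P with hT
  -- The first-order term is matched with `v / 2` minus its diagonal part `b_k² c_k / 2`; that part
  -- is already taken out of the quadratic Taylor term in `e1`.
  have e2 : ∫ ω, expSum b Y (k + 1) ω ∂P
        - (Real.exp (-(v / 2)) : ℂ) * ∫ ω, expSum b Y k ω ∂P
      = ∑ i ∈ Finset.range k, T i + ((∫ ω, expSum b Y k ω * R ω ∂P)
        - (b k ^ 2 / 2 : ℝ) * (∫ ω, expSum b Y k ω * ((Y k ω * Y k ω - c k : ℝ) : ℂ) ∂P)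
        - (Real.exp (-(v / 2)) - 1 - (-(v / 2)) : ℝ) * ∫ ω, expSum b Y k ω ∂P) := by
    have hv' : v = b k ^ 2 * c k + 2 * ∑ i ∈ Finset.range k, b i * b k * c i := rfl
    have hTs : ∑ i ∈ Finset.range k, T i
        = Complex.I * b k * ∫ ω, expSum b Y k ω * (Y k ω : ℂ) ∂P
          + (∑ i ∈ Finset.range k, b i * b k * c i : ℝ) * ∫ ω, expSum b Y k ω ∂P := by
      rw [H.integral_expSum_mul_eq_sum b k, hT, Finset.sum_add_distrib, ← Finset.mul_sum,
        ← Finset.sum_mul]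
      push_cast
      rfl
    have hS : ∑ i ∈ Finset.range k, b i * b k * c i = (v - b k ^ 2 * c k) / 2 := by
      rw [hv']; ring
    rw [hTs, hS, e1]
    push_cast
    ring
  rw [e2]
  refine (norm_add_le _ _).trans (add_le_add ?_ ?_)
  · refine (norm_sum_le _ _).trans (Finset.sum_le_sum fun i hi => ?_)
    have hik := Finset.mem_range.1 hi
    split_ifs with h
    · exact H.norm_cross_term_le_near b hb hδ1 L m hik (by omega)
    · exact H.norm_cross_term_le_far b hik
  · refine (norm_sub_le _ _).trans ?_
    refine (add_le_add_left (norm_sub_le _ _) _).trans ?_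
    have h1 : ‖∫ ω, expSum b Y k ω * R ω ∂P‖ ≤ 3 * δ * b k ^ 2 :=
      norm_integral_le_of_forall fun ω => by
        rw [norm_mul, norm_expSum, one_mul]
        exact hRb ω
    have h2 := H.norm_integral_expSum_mul_pair_le b hb L (le_refl k)
    have h3 : ‖∫ ω, expSum b Y k ω ∂P‖ ≤ 1 :=
      norm_integral_le_of_forall fun ω => (norm_expSum b Y k ω).le
    have hvb := H.abs_varIncr_le b hΘ hb k
    rw [← hv] at hvb
    have h4 : |Real.exp (-(v / 2)) - 1 - (-(v / 2))| ≤ b k ^ 2 * (δ * (1 + 2 * Θ)) ^ 2 := by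
      have hv1 : |v| ≤ 1 := hvb.trans (by nlinarith [hb k, abs_nonneg (b k)])
      refine (Real.abs_exp_sub_one_sub_id_le (by
        rw [abs_neg, abs_div, abs_two]; linarith)).trans ?_
      have : v ^ 2 ≤ (|b k| * (δ * (1 + 2 * Θ))) ^ 2 := by
        rw [← sq_abs v]
        exact pow_le_pow_left₀ (abs_nonneg _) hvb 2
      rw [mul_pow, sq_abs] at this
      nlinarith [sq_nonneg v]
    rw [norm_mul, norm_mul, Complex.norm_real, Complex.norm_real, Real.norm_eq_abs,
      Real.norm_eq_abs, abs_of_nonneg (by positivity : 0 ≤ b k ^ 2 / 2)]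
    have h5 : |Real.exp (-(v / 2)) - 1 - (-(v / 2))| * ‖∫ ω, expSum b Y k ω ∂P‖
        ≤ b k ^ 2 * (δ * (1 + 2 * Θ)) ^ 2 :=
      (mul_le_of_le_one_right (abs_nonneg _) h3).trans h4
    have h6 := mul_le_mul_of_nonneg_left h2 (by positivity : 0 ≤ b k ^ 2 / 2)
    have h7 : 0 ≤ b k ^ 2 * (2 * L * δ + θ L) := by
      have := H.nonneg L
      positivity
    linarith

/-- With `exp (V_n / 2)` as integrating factor, `φ_n exp (V_n / 2) - 1` is a sum of weighted
one-step errors. The lag weights total at most `m κ + 2 τ`, so the Schur bound makes the total error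
a multiple of `C`. -/
theorem norm_integral_expSum_sub_exp_le {Θ : ℝ}
    (hΘ : ∀ n, ∑ d ∈ Finset.range n, θ d ≤ Θ) {δ : ℝ} (hb : ∀ i, |b i| ≤ δ)
    (hδ : δ * (1 + 2 * Θ) ≤ 1) (L m N : ℕ) {C τ : ℝ} (hC : ∑ i ∈ Finset.range N, b i ^ 2 ≤ C)
    (hτ : ∀ n, ∑ d ∈ Finset.Ico m n, θ d ≤ τ) :
    ‖∫ ω, expSum b Y N ω ∂P - (Real.exp (-((∫ ω, partialSum b Y N ω ^ 2 ∂P) / 2)) : ℂ)‖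
      ≤ Real.exp ((1 + 2 * Θ) * C) * (C * (m * (δ + (2 * L * δ + θ L) + m * δ) + 2 * τ
        + ((2 * L * δ + θ L) + 3 * δ + (δ * (1 + 2 * Θ)) ^ 2))) := by
  have hδ0 : 0 ≤ δ := (abs_nonneg _).trans (hb 0)
  have hΘ0 : 0 ≤ Θ := by simpa using hΘ 0
  have hτ0 : 0 ≤ τ := by simpa using hτ 0
  have hθL := H.nonneg L
  set κ := δ + (2 * L * δ + θ L) + m * δ with hκ
  have hκ0 : 0 ≤ κ := by positivity
  set c := (2 * L * δ + θ L) + 3 * δ + (δ * (1 + 2 * Θ)) ^ 2 with hc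
  have hc0 : 0 ≤ c := by positivity
  set φ : ℕ → ℂ := fun k => ∫ ω, expSum b Y k ω ∂P with hφ
  set v := varIncr P b Y with hv
  set V : ℕ → ℝ := fun n => ∑ k ∈ Finset.range n, v k with hV
  set u : ℕ → ℝ := fun d => if d < m then κ else 2 * θ d with hu
  have hu0 : ∀ d, 0 ≤ u d := fun d => by
    simp only [hu]
    split_ifs
    exacts [hκ0, mul_nonneg zero_le_two (H.nonneg d)]
  have hC0 : 0 ≤ C := (Finset.sum_nonneg fun _ _ => sq_nonneg _).trans hC
  have hVb : ∀ n ≤ N, |V n| ≤ (1 + 2 * Θ) * C := fun n hn => by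
    refine (Finset.abs_sum_le_sum_abs _ _).trans ((sum_abs_varIncr_le H.nonneg (fun k => H.abs_cov_le_one k k)
      (fun i k => H.abs_cov_le) hΘ b n).trans ?_)
    gcongr
    exact (Finset.sum_le_sum_of_subset_of_nonneg (Finset.range_mono hn)
      fun _ _ _ => sq_nonneg _).trans hC
  have hsum_u : ∑ d ∈ Finset.range N, u d ≤ m * κ + 2 * τ := by
    have h1 : ∑ d ∈ Finset.range N, u d ≤ ∑ d ∈ Finset.range (max m N), u d :=
      Finset.sum_le_sum_of_subset_of_nonneg (Finset.range_mono (le_max_right _ _))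
        fun _ _ _ => hu0 _
    rw [← Finset.sum_range_add_sum_Ico _ (le_max_left m N)] at h1
    have h2 : ∑ d ∈ Finset.range m, u d = m * κ := by
      rw [Finset.sum_congr rfl fun d hd => if_pos (Finset.mem_range.1 hd)]
      simp
    have h3 : ∑ d ∈ Finset.Ico m (max m N), u d = 2 * ∑ d ∈ Finset.Ico m (max m N), θ d := by
      rw [Finset.mul_sum]
      exact Finset.sum_congr rfl fun d hd => if_neg (not_lt.2 (Finset.mem_Ico.1 hd).1)
    have := hτ (max m N)
    linarith
  set D : ℕ → ℂ := fun k => φ (k + 1) - (Real.exp (-(v k / 2)) : ℂ) * φ k with hD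
  have hDsum : ∑ k ∈ Finset.range N, ‖D k‖ ≤ C * (m * κ + 2 * τ + c) := by
    refine (Finset.sum_le_sum fun k _ =>
      H.norm_integral_expSum_succ_sub_exp_mul_le b hΘ hb hδ L m k).trans ?_
    rw [Finset.sum_add_distrib, ← Finset.sum_mul]
    have h1 := sum_mul_abs_le b u hu0 N
    have h2 : (∑ d ∈ Finset.range N, u d) * ∑ i ∈ Finset.range N, b i ^ 2
        ≤ (m * κ + 2 * τ) * C := by
      gcongr
    have h3 : (∑ i ∈ Finset.range N, b i ^ 2) * c ≤ C * c := by gcongr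
    have h4 := h1.trans h2
    linarith
  have htel : ∀ n, φ n * (Real.exp (V n / 2) : ℂ) - 1
      = ∑ k ∈ Finset.range n, (Real.exp (V (k + 1) / 2) : ℂ) * D k := by
    intro n
    induction n with
    | zero => simp [hφ, hV, expSum_zero]
    | succ n ih =>
      rw [Finset.sum_range_succ, ← ih, hD]
      have : Real.exp (V (n + 1) / 2) * Real.exp (-(v n / 2)) = Real.exp (V n / 2) := by
        rw [← Real.exp_add]
        congr 1
        simp only [hV, Finset.sum_range_succ]
        ring
      rw [← this]
      push_cast
      ring
  have hfin : φ N - (Real.exp (-(V N / 2)) : ℂ)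
      = (Real.exp (-(V N / 2)) : ℂ) * (φ N * (Real.exp (V N / 2) : ℂ) - 1) := by
    have : (Real.exp (-(V N / 2)) : ℂ) * (Real.exp (V N / 2) : ℂ) = 1 := by
      rw [← Complex.ofReal_mul, ← Real.exp_add]
      simp
    linear_combination (-φ N) * this
  rw [integral_partialSum_sq H.integrable_mul b N]
  change ‖φ N - (Real.exp (-(V N / 2)) : ℂ)‖ ≤ _
  rw [hfin, htel, norm_mul, Complex.norm_real, Real.norm_eq_abs, abs_of_pos (Real.exp_pos _)]
  -- Half of the exponent pays for the integrating factors in the sum, the other half for undoing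
  -- the last one.
  have hE : ∀ x, |x| ≤ (1 + 2 * Θ) * C → Real.exp (x / 2) ≤ Real.exp ((1 + 2 * Θ) * C / 2) :=
    fun x hx => Real.exp_le_exp.2 (by linarith [le_abs_self x])
  have h1 : Real.exp (-(V N / 2)) ≤ Real.exp ((1 + 2 * Θ) * C / 2) := by
    rw [← neg_div]
    exact hE _ (by rw [abs_neg]; exact hVb N le_rfl)
  have h2 : ‖∑ k ∈ Finset.range N, (Real.exp (V (k + 1) / 2) : ℂ) * D k‖
      ≤ Real.exp ((1 + 2 * Θ) * C / 2) * (C * (m * κ + 2 * τ + c)) := by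
    refine (norm_sum_le _ _).trans (le_trans ?_
      (mul_le_mul_of_nonneg_left hDsum (Real.exp_pos _).le))
    rw [Finset.mul_sum]
    refine Finset.sum_le_sum fun k hk => ?_
    rw [norm_mul, Complex.norm_real, Real.norm_eq_abs, abs_of_pos (Real.exp_pos _)]
    exact mul_le_mul_of_nonneg_right (hE _ (hVb _ (Finset.mem_range.1 hk))) (norm_nonneg _)
  calc _ ≤ Real.exp ((1 + 2 * Θ) * C / 2)
        * (Real.exp ((1 + 2 * Θ) * C / 2) * (C * (m * κ + 2 * τ + c))) := by gcongr
    _ = _ := by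
      rw [← mul_assoc, ← Real.exp_add, add_halves]

end CausalWeakDep

/-- The characteristic function of a weighted sum with uniformly small weights is close to that of
the Gaussian law with the same variance, uniformly over all weakly dependent sequences with a
common summable rate. -/
theorem exists_delta_norm_integral_expSum_sub_exp_le {θ : ℕ → ℝ} (hθ0 : ∀ d, 0 ≤ θ d)
    (hθ : Summable θ) (C : ℝ) {ε : ℝ} (hε : 0 < ε) :
    ∃ δ > 0, ∀ (P : Measure Ω) [IsProbabilityMeasure P] (F : ℕ → MeasurableSpace Ω)
      (Y : ℕ → Ω → ℝ), CausalWeakDep P F Y θ → ∀ (b : ℕ → ℝ) (N : ℕ), (∀ i, |b i| ≤ δ) →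
      ∑ i ∈ Finset.range N, b i ^ 2 ≤ C →
      ‖∫ ω, expSum b Y N ω ∂P - (Real.exp (-((∫ ω, partialSum b Y N ω ^ 2 ∂P) / 2)) : ℂ)‖
        ≤ ε := by
  set Θ := ∑' d, θ d
  have hΘ : ∀ n, ∑ d ∈ Finset.range n, θ d ≤ Θ := fun n => hθ.sum_le_tsum _ fun _ _ => hθ0 _
  have hΘ0 : 0 ≤ Θ := tsum_nonneg hθ0
  set E := Real.exp ((1 + 2 * Θ) * C)
  have htail : ∀ η > 0, ∃ m : ℕ, ∀ n, ∑ d ∈ Finset.Ico m n, θ d ≤ η := fun η hη => by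
    have h1 : Tendsto (fun m => ∑ d ∈ Finset.range m, θ d) atTop (𝓝 Θ) :=
      hθ.hasSum.tendsto_sum_nat
    obtain ⟨m, hm⟩ := (h1.eventually (lt_mem_nhds (show Θ - η < Θ by linarith))).exists
    refine ⟨m, fun n => ?_⟩
    by_cases hmn : m ≤ n
    · have := Finset.sum_range_add_sum_Ico θ hmn
      have := hΘ n
      linarith
    · rw [Finset.Ico_eq_empty_of_le (by omega)]
      simpa using hη.le
  -- The order of choice matters: the tail `τ`, then the cutoff `m` with that tail, then `L` with `m
  -- θ(L)` small, and last `δ`, which absorbs every factor in `m` and `L`.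
  have hlim1 : Tendsto (fun τ : ℝ => E * (C * (2 * τ))) (𝓝[>] 0) (𝓝 0) := by
    have : Continuous fun τ : ℝ => E * (C * (2 * τ)) := by fun_prop
    simpa using (this.tendsto 0).mono_left nhdsWithin_le_nhds
  obtain ⟨τ, hτε, hτ0 : 0 < τ⟩ :=
    ((hlim1.eventually (gt_mem_nhds hε)).and self_mem_nhdsWithin).exists
  obtain ⟨m, hm⟩ := htail τ hτ0
  have hlim2 : Tendsto (fun L : ℕ => E * (C * (m * θ L + 2 * τ + θ L))) atTop
      (𝓝 (E * (C * (2 * τ)))) := by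
    have h : Continuous fun x : ℝ => E * (C * (m * x + 2 * τ + x)) := by fun_prop
    have := (h.tendsto 0).comp hθ.tendsto_atTop_zero
    simpa [Function.comp_def] using this
  obtain ⟨L, hL⟩ := (hlim2.eventually (gt_mem_nhds hτε)).exists
  have hlim3 : Tendsto (fun δ : ℝ => E * (C * (m * (δ + (2 * L * δ + θ L) + m * δ) + 2 * τ
        + ((2 * L * δ + θ L) + 3 * δ + (δ * (1 + 2 * Θ)) ^ 2)))) (𝓝[>] 0)
      (𝓝 (E * (C * (m * θ L + 2 * τ + θ L)))) := by
    have h : Continuous fun δ : ℝ => E * (C * (m * (δ + (2 * L * δ + θ L) + m * δ) + 2 * τ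
        + ((2 * L * δ + θ L) + 3 * δ + (δ * (1 + 2 * Θ)) ^ 2))) := by fun_prop
    simpa using (h.tendsto 0).mono_left nhdsWithin_le_nhds
  have hlim4 : Tendsto (fun δ : ℝ => δ * (1 + 2 * Θ)) (𝓝[>] 0) (𝓝 0) := by
    have h : Continuous fun δ : ℝ => δ * (1 + 2 * Θ) := by fun_prop
    simpa using (h.tendsto 0).mono_left nhdsWithin_le_nhds
  obtain ⟨δ, ⟨hδ3, hδ4⟩, hδ0 : 0 < δ⟩ := (((hlim3.eventually (gt_mem_nhds hL)).and
    (hlim4.eventually (gt_mem_nhds one_pos))).and self_mem_nhdsWithin).exists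
  refine ⟨δ, hδ0, fun P _ F Y H b N hb hC => ?_⟩
  exact (H.norm_integral_expSum_sub_exp_le b hΘ hb hδ4.le L m N hC hm).trans hδ3.le

/-! ### From the coefficient `θ₂` to covariance bounds -/

theorem abs_integral_mul_le_sqrt_mul_sqrt {P : Measure Ω} {f g : Ω → ℝ} (hf : MemLp f 2 P)
    (hg : MemLp g 2 P) :
    |∫ ω, f ω * g ω ∂P| ≤ √(∫ ω, f ω ^ 2 ∂P) * √(∫ ω, g ω ^ 2 ∂P) := by
  have h := integral_mul_norm_le_Lp_mul_Lq (μ := P) (f := f) (g := g)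
    Real.HolderConjugate.two_two (by simpa using hf) (by simpa using hg)
  simp only [Real.norm_eq_abs, Real.rpow_ofNat, sq_abs, ← Real.sqrt_eq_rpow] at h
  refine le_trans ?_ h
  refine (abs_integral_le_integral_abs).trans (le_of_eq ?_)
  simp only [abs_mul]

theorem sqrt_integral_sq_le_of_eLpNorm_le {P : Measure Ω} {f : Ω → ℝ} {c : ℝ} (hc : 0 ≤ c)
    (hf : AEStronglyMeasurable f P) (h : eLpNorm f 2 P ≤ ENNReal.ofReal c) :
    √(∫ ω, f ω ^ 2 ∂P) ≤ c := by
  have hL : MemLp f 2 P := ⟨hf, h.trans_lt ENNReal.ofReal_lt_top⟩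
  rw [hL.eLpNorm_eq_integral_rpow_norm (by norm_num) (by norm_num),
    ENNReal.ofReal_le_ofReal_iff hc] at h
  simp only [ENNReal.toReal_ofNat, Real.norm_eq_abs, Real.rpow_ofNat, sq_abs] at h
  rwa [Real.sqrt_eq_rpow, one_div]

theorem past_le {ξ : ℤ → Ω → ℝ} (hmeas : ∀ i, Measurable (ξ i)) (p : ℤ) : past ξ p ≤ mΩ :=
  iSup₂_le fun i _ => (hmeas i).comap_le

theorem past_mono (ξ : ℤ → Ω → ℝ) : Monotone (past ξ) := fun _ _ hpq =>
  iSup₂_le fun i hi => le_iSup₂_of_le i (hi.trans hpq) le_rfl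

theorem measurable_past (ξ : ℤ → Ω → ℝ) (i : ℤ) : Measurable[past ξ i] (ξ i) :=
  (comap_measurable (ξ i)).mono (le_iSup₂_of_le i le_rfl le_rfl) le_rfl

theorem theta2Coeff_le {P : Measure Ω} {M : ℤ → MeasurableSpace Ω} {ξ : ℤ → Ω → ℝ} {n l : ℕ}
    (hl : 1 ≤ l) {p : ℤ} {j : Fin l → ℤ} (hj : StrictMono j) (hpj : ∀ i, p + (n : ℤ) ≤ j i) :
    theta2Coeff P (M p) (fun ω i => ξ (j i) ω) ≤ l * theta2 P M ξ n := by
  have h1 : (l : ℝ≥0∞)⁻¹ * theta2Coeff P (M p) (fun ω i => ξ (j i) ω) ≤ theta2 P M ξ n := by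
    refine le_trans ?_ (le_iSup₂_of_le l hl le_rfl)
    refine le_trans ?_ (le_iSup₂_of_le l ⟨hl, le_rfl⟩ le_rfl)
    gcongr
    exact le_iSup_of_le p (le_iSup₂_of_le j ⟨hj, hpj⟩ le_rfl)
  have h0 : (l : ℝ≥0∞) ≠ 0 := by exact_mod_cast (by omega : l ≠ 0)
  calc _ = (l : ℝ≥0∞) * ((l : ℝ≥0∞)⁻¹ * theta2Coeff P (M p) (fun ω i => ξ (j i) ω)) := by
        rw [← mul_assoc, ENNReal.mul_inv_cancel h0 (ENNReal.natCast_ne_top l), one_mul]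
    _ ≤ _ := by gcongr

/-- Conditioning on the past replaces `f(X)` by its conditional expectation; Cauchy-Schwarz then
isolates the `L²` norm that `θ₂` controls. The factor `l` undoes the normalisation `1 / l`. -/
theorem abs_integral_mul_sub_le {P : Measure Ω} [IsProbabilityMeasure P]
    {ξ : ℤ → Ω → ℝ} (hmeas : ∀ i, Measurable (ξ i)) {n : ℕ} {c : ℝ} (hc : 0 ≤ c)
    (hbound : theta2 P (past ξ) ξ n ≤ ENNReal.ofReal c) {l : ℕ} (hl : 1 ≤ l) {p : ℤ}
    {j : Fin l → ℤ} (hj : StrictMono j) (hpj : ∀ i, p + (n : ℤ) ≤ j i)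
    {f : (Fin l → ℝ) → ℝ} (hf : IsLip1 f) (hfL : MemLp (fun ω => f (fun i => ξ (j i) ω)) 2 P)
    {Z : Ω → ℝ} (hZ : Measurable[past ξ p] Z) (hZL : MemLp Z 2 P) :
    |∫ ω, Z ω * (f (fun i => ξ (j i) ω) - ∫ ω', f (fun i => ξ (j i) ω') ∂P) ∂P|
      ≤ √(∫ ω, Z ω ^ 2 ∂P) * (l * c) := by
  set X : Ω → ℝ := fun ω => f (fun i => ξ (j i) ω) with hX
  set μ := ∫ ω, X ω ∂P
  have hm := past_le hmeas p
  have hXμ : MemLp (fun ω => X ω - μ) 2 P := hfL.sub (memLp_const μ)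
  have hE : MemLp (P[X | past ξ p]) 2 P := hfL.condExp (by norm_num)
  have hEμ : MemLp (fun ω => (P[X | past ξ p]) ω - μ) 2 P := hE.sub (memLp_const μ)
  have hXi : Integrable X P := hfL.integrable (by norm_num)
  have hXμi : Integrable (fun ω => X ω - μ) P := hXi.sub (integrable_const _)
  have hprod : Integrable (Z * fun ω => X ω - μ) P := hZL.integrable_mul hXμ
  have h1 := condExp_mul_of_stronglyMeasurable_left (m := past ξ p) hZ.stronglyMeasurable
    hprod hXμi
  have h2 : P[fun ω => X ω - μ | past ξ p] =ᵐ[P] fun ω => (P[X | past ξ p]) ω - μ := by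
    have := condExp_sub hXi (integrable_const μ) (past ξ p) (μ := P)
    rw [condExp_const hm] at this
    exact this
  have h3 : ∫ ω, Z ω * (X ω - μ) ∂P = ∫ ω, Z ω * ((P[X | past ξ p]) ω - μ) ∂P := by
    rw [← integral_condExp hm (f := fun ω => Z ω * (X ω - μ))]
    refine integral_congr_ae ?_
    filter_upwards [h1, h2] with ω hω1 hω2
    change (P[Z * fun ω => X ω - μ | past ξ p]) ω = _
    rw [hω1, Pi.mul_apply, hω2]
  rw [h3]
  refine (abs_integral_mul_le_sqrt_mul_sqrt hZL hEμ).trans ?_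
  gcongr
  refine sqrt_integral_sq_le_of_eLpNorm_le (by positivity) hEμ.1 ?_
  have h4 : eLpNorm (fun ω => (P[X | past ξ p]) ω - μ) 2 P
      ≤ theta2Coeff P (past ξ p) (fun ω i => ξ (j i) ω) := le_iSup₂_of_le f hf le_rfl
  refine h4.trans ((theta2Coeff_le hl hj hpj).trans ?_)
  rw [ENNReal.ofReal_mul (by positivity), ENNReal.ofReal_natCast]
  gcongr

/-- The factor `2` comes from treating real and imaginary parts separately. -/
theorem norm_integral_mul_ofReal_le {Ω : Type*} {m mΩ : MeasurableSpace Ω} {P : Measure Ω}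
    {W : Ω → ℝ}
    (hm : m ≤ mΩ) (hW : Integrable W P) {c : ℝ}
    (h : ∀ Z : Ω → ℝ, Measurable[m] Z → (∀ ω, |Z ω| ≤ 1) → |∫ ω, Z ω * W ω ∂P| ≤ c)
    {Z : Ω → ℂ} (hZ : Measurable[m] Z) (hZ1 : ∀ ω, ‖Z ω‖ ≤ 1) :
    ‖∫ ω, Z ω * (W ω : ℂ) ∂P‖ ≤ 2 * c := by
  have hre : Measurable[m] fun ω => (Z ω).re := Complex.measurable_re.comp hZ
  have him : Measurable[m] fun ω => (Z ω).im := Complex.measurable_im.comp hZ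
  have hre1 : ∀ ω, |(Z ω).re| ≤ 1 := fun ω => (Complex.abs_re_le_norm _).trans (hZ1 ω)
  have him1 : ∀ ω, |(Z ω).im| ≤ 1 := fun ω => (Complex.abs_im_le_norm _).trans (hZ1 ω)
  have hint : ∀ {Z : Ω → ℝ}, Measurable[m] Z → (∀ ω, |Z ω| ≤ 1) →
      Integrable (fun ω => Z ω * W ω) P := fun hZ h1 =>
    hW.bdd_mul (c := 1) (hZ.mono hm le_rfl).aestronglyMeasurable (.of_forall h1)
  have e : ∫ ω, Z ω * (W ω : ℂ) ∂P = ((∫ ω, (Z ω).re * W ω ∂P : ℝ) : ℂ)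
      + ((∫ ω, (Z ω).im * W ω ∂P : ℝ) : ℂ) * Complex.I := by
    rw [← integral_complex_ofReal, ← integral_complex_ofReal, ← integral_mul_const,
      ← integral_add (hint hre hre1).ofReal ((hint him him1).ofReal.mul_const _)]
    congr 1
    ext ω
    nth_rewrite 1 [← Complex.re_add_im (Z ω)]
    push_cast
    ring
  rw [e]
  refine (norm_add_le _ _).trans ?_
  rw [norm_mul, Complex.norm_I, mul_one, Complex.norm_real, Complex.norm_real]
  linarith [h _ hre hre1, h _ him him1, Real.norm_eq_abs (∫ ω, (Z ω).re * W ω ∂P),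
    Real.norm_eq_abs (∫ ω, (Z ω).im * W ω ∂P)]

/-- Truncation of a real number to the interval `[-T, T]`. -/
noncomputable def clip (T x : ℝ) : ℝ := max (-T) (min T x)

theorem abs_clip_le {T : ℝ} (hT : 0 ≤ T) (x : ℝ) : |clip T x| ≤ T :=
  abs_le.2 ⟨le_max_left _ _, max_le (by linarith) (min_le_left _ _)⟩

theorem clip_of_abs_le {T x : ℝ} (h : |x| ≤ T) : clip T x = x := by
  rw [clip, min_eq_right (abs_le.1 h).2, max_eq_right (abs_le.1 h).1]

theorem abs_clip_sub_clip_le (T x y : ℝ) : |clip T x - clip T y| ≤ |x - y| := by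
  unfold clip
  grind

/-- The residual, like the truncation, has slope `0` or `1`, so `θ₂` applies to it directly. -/
theorem abs_sub_clip_sub_le {T : ℝ} (hT : 0 ≤ T) (x y : ℝ) :
    |(x - clip T x) - (y - clip T y)| ≤ |x - y| := by
  unfold clip
  grind

theorem abs_sub_clip_le {T : ℝ} (hT : 0 ≤ T) (x : ℝ) : |x - clip T x| ≤ |x| := by
  unfold clip
  grind

theorem measurable_clip (T : ℝ) : Measurable (clip T) := by
  unfold clip
  fun_prop

theorem isLip1_comp_apply {l : ℕ} (i : Fin l) {h : ℝ → ℝ} (hh : ∀ x y, |h x - h y| ≤ |x - y|) :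
    IsLip1 fun x : Fin l → ℝ => h (x i) := fun x y =>
  (hh _ _).trans (Finset.single_le_sum (f := fun i => |x i - y i|) (fun _ _ => abs_nonneg _)
    (Finset.mem_univ i))

theorem isLip1_mul {h h' : ℝ → ℝ} (hh : ∀ x y, |h x - h y| ≤ |x - y|)
    (hh' : ∀ x y, |h' x - h' y| ≤ |x - y|) (h1 : ∀ x, |h x| ≤ 1) (h1' : ∀ x, |h' x| ≤ 1) :
    IsLip1 fun x : Fin 2 → ℝ => h (x 0) * h' (x 1) := fun x y => by
  have e : h (x 0) * h' (x 1) - h (y 0) * h' (y 1)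
      = (h (x 0) - h (y 0)) * h' (x 1) + h (y 0) * (h' (x 1) - h' (y 1)) := by ring
  rw [e, Fin.sum_univ_two]
  refine (abs_add_le _ _).trans (add_le_add ?_ ?_)
  · rw [abs_mul]
    exact (mul_le_of_le_one_right (abs_nonneg _) (h1' _)).trans (hh _ _)
  · rw [abs_mul]
    exact (mul_le_of_le_one_left (abs_nonneg _) (h1 _)).trans (hh' _ _)

/-- The truncation at level `T`, centred at `c` and scaled to be bounded by `1`. -/
noncomputable def scaledClip (T c x : ℝ) : ℝ := (clip T x - c) / (2 * T)

theorem abs_scaledClip_le {T c : ℝ} (hT : 0 < T) (hc : |c| ≤ T) (x : ℝ) :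
    |scaledClip T c x| ≤ 1 := by
  rw [scaledClip, abs_div, abs_of_pos (by positivity : 0 < 2 * T), div_le_one (by positivity)]
  have := abs_clip_le hT.le x
  have := abs_sub (clip T x) c
  linarith

/-- The constant `1 / 2`, rather than `1`, makes the square of a scaled truncation `1`-Lipschitz. -/
theorem abs_scaledClip_sub_le {T : ℝ} (hT : 1 ≤ T) (c x y : ℝ) :
    |scaledClip T c x - scaledClip T c y| ≤ 1 / 2 * |x - y| := by
  rw [scaledClip, scaledClip, ← sub_div, sub_sub_sub_cancel_right, abs_div,
    abs_of_pos (by positivity : 0 < 2 * T), div_le_iff₀ (by positivity)]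
  have := abs_clip_sub_clip_le T x y
  nlinarith [abs_nonneg (x - y)]

theorem measurable_scaledClip (T c : ℝ) : Measurable (scaledClip T c) :=
  ((measurable_clip T).sub_const c).div_const _

/-! ### Weak dependence of the truncated variables -/

section Sequence

variable {P : Measure Ω} [IsProbabilityMeasure P] {ξ : ℤ → Ω → ℝ}
  (hmeas : ∀ i, Measurable (ξ i)) {g : ℝ → ℝ} (hg0 : ∀ x, 0 < x → 0 ≤ g x)
  (hgbound : ∀ n : ℕ, 1 ≤ n → theta2 P (past ξ) ξ n ≤ ENNReal.ofReal (g (n : ℝ)))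

include hmeas

theorem integrable_clip {T : ℝ} (hT : 0 ≤ T) (i : ℤ) : Integrable (fun ω => clip T (ξ i ω)) P :=
  integrable_of_norm_le ((measurable_clip T).comp (hmeas i)) fun ω => abs_clip_le hT (ξ i ω)

theorem abs_integral_clip_le {T : ℝ} (hT : 0 ≤ T) (i : ℤ) :
    |∫ ω, clip T (ξ i ω) ∂P| ≤ T := by
  have := norm_integral_le_of_norm_le_const (μ := P) (C := T)
    (.of_forall fun ω => abs_clip_le hT (ξ i ω) : ∀ᵐ ω ∂P, ‖clip T (ξ i ω)‖ ≤ T)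
  simpa using this

include hg0 hgbound

/-- The window from `-K` is moved to start at `0`, and the filtration is shifted by one so that `Y
j` is `F (j + 1)`-measurable. A gap `d` then means a true distance `d + 1 ≥ 1`. The constant `4` is
`2` for complex test variables times `l = 2` for pairs. -/
theorem causalWeakDep_scaledClip {T : ℝ} (hT : 1 ≤ T) (K : ℤ) :
    CausalWeakDep P (fun p : ℕ => past ξ (p - 1 - K))
      (fun (j : ℕ) ω => scaledClip T (∫ ω', clip T (ξ (j - K) ω') ∂P) (ξ (j - K) ω))
      (fun d : ℕ => 4 * g ((d + 1 : ℕ) : ℝ)) := by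
  have hT0 : 0 < T := by linarith
  have hb : ∀ (i : ℤ) x, |scaledClip T (∫ ω', clip T (ξ i ω') ∂P) x| ≤ 1 :=
    fun i => abs_scaledClip_le hT0 (abs_integral_clip_le hmeas hT0.le i)
  have hlip : ∀ c x y, |scaledClip T c x - scaledClip T c y| ≤ |x - y| := fun c x y =>
    (abs_scaledClip_sub_le hT c x y).trans (by linarith [abs_nonneg (x - y)])
  have hm : ∀ (i : ℤ), Measurable fun ω =>
      scaledClip T (∫ ω', clip T (ξ i ω') ∂P) (ξ i ω) :=
    fun i => (measurable_scaledClip _ _).comp (hmeas i)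
  have hcent : ∀ i : ℤ, ∫ ω, scaledClip T (∫ ω', clip T (ξ i ω') ∂P) (ξ i ω) ∂P = 0 := by
    intro i
    unfold scaledClip
    rw [integral_div, integral_sub (integrable_clip hmeas hT0.le i) (integrable_const _)]
    simp
  have hg0' : ∀ d : ℕ, 0 ≤ g ((d + 1 : ℕ) : ℝ) := fun d => hg0 _ (by positivity)
  have key : ∀ {l : ℕ} (_ : 1 ≤ l) {p : ℤ} {d : ℕ} {j : Fin l → ℤ} (_ : StrictMono j)
      (_ : ∀ i, p + ((d + 1 : ℕ) : ℤ) ≤ j i) {f : (Fin l → ℝ) → ℝ} (_ : IsLip1 f)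
      (_ : ∀ x, |f x| ≤ 1) (_ : Measurable f) {Z : Ω → ℂ} (_ : Measurable[past ξ p] Z)
      (_ : ∀ ω, ‖Z ω‖ ≤ 1),
      ‖∫ ω, Z ω * ((f (fun i => ξ (j i) ω) - ∫ ω', f (fun i => ξ (j i) ω') ∂P : ℝ) : ℂ) ∂P‖
        ≤ 2 * (l * g ((d + 1 : ℕ) : ℝ)) := by
    intro l hl p d j hj hpj f hf hf1 hfm Z hZ hZ1
    have hXm : Measurable fun ω => f (fun i => ξ (j i) ω) :=
      hfm.comp (measurable_pi_lambda _ fun i => hmeas _)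
    have hL : MemLp (fun ω => f (fun i => ξ (j i) ω)) 2 P :=
      .of_bound hXm.aestronglyMeasurable 1 (.of_forall fun ω => hf1 _)
    refine norm_integral_mul_ofReal_le (past_le hmeas p)
      ((hL.integrable (by norm_num)).sub (integrable_const _)) (fun Z hZ hZ1 => ?_) hZ hZ1
    have hZL : MemLp Z 2 P :=
      .of_bound (hZ.mono (past_le hmeas p) le_rfl).aestronglyMeasurable 1 (.of_forall hZ1)
    refine (abs_integral_mul_sub_le hmeas (hg0' d) (hgbound _ (by omega)) hl hj hpj hf hL hZ
      hZL).trans ?_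
    refine mul_le_of_le_one_left (mul_nonneg (by positivity) (hg0' d)) ?_
    rw [Real.sqrt_le_one]
    have h1 : ∀ ω, Z ω ^ 2 ≤ 1 := fun ω => (sq_le_one_iff_abs_le_one _).2 (hZ1 ω)
    calc ∫ ω, Z ω ^ 2 ∂P ≤ ∫ _, (1 : ℝ) ∂P :=
          integral_mono hZL.integrable_sq (integrable_const _) h1
      _ = 1 := by simp
  refine ⟨fun p q hpq => past_mono ξ (by omega), fun p => past_le hmeas _, fun j => ?_,
    fun j ω => hb _ _, fun j => hcent _, fun d => mul_nonneg (by norm_num) (hg0' d), ?_, ?_⟩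
  · have := (measurable_scaledClip T (∫ ω', clip T (ξ (j - K) ω') ∂P)).comp
      (measurable_past ξ (j - K))
    rwa [show (((j + 1 : ℕ) : ℤ) - 1 - K) = j - K by push_cast; ring]
  · intro p k Z hpk hZ hZ1
    have := key le_rfl (p := p - 1 - K) (d := k - p) (j := fun _ : Fin 1 => (k : ℤ) - K)
      (Subsingleton.strictMono _) (fun _ => by omega)
      (isLip1_comp_apply 0 (hlip (∫ ω', clip T (ξ (k - K) ω') ∂P))) (fun x => hb _ _)
      ((measurable_scaledClip _ _).comp (measurable_pi_apply 0)) hZ hZ1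
    simp only [hcent, sub_zero] at this
    refine this.trans ?_
    have := hg0' (k - p)
    push_cast at this ⊢
    linarith
  · intro p i k Z hpi hik hZ hZ1
    -- Equal indices do not form a strictly increasing pair, so the square is treated as a function
    -- of a single coordinate.
    rcases hik.eq_or_lt with rfl | hik
    · have := key le_rfl (p := p - 1 - K) (d := i - p) (j := fun _ : Fin 1 => (i : ℤ) - K)
        (f := fun x => scaledClip T (∫ ω', clip T (ξ (i - K) ω') ∂P) (x 0)
          * scaledClip T (∫ ω', clip T (ξ (i - K) ω') ∂P) (x 0))
        (Subsingleton.strictMono _) (fun _ => by omega)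
        (isLip1_comp_apply 0 (h := fun x => scaledClip T (∫ ω', clip T (ξ (i - K) ω') ∂P) x
          * scaledClip T (∫ ω', clip T (ξ (i - K) ω') ∂P) x) fun x y => by
            have h1 := abs_scaledClip_sub_le hT (∫ ω', clip T (ξ (i - K) ω') ∂P) x y
            have h2 := hb (i - K) x
            have h3 := hb (i - K) y
            rw [mul_self_sub_mul_self, abs_mul]
            have h4 := abs_add_le (scaledClip T (∫ ω', clip T (ξ (i - K) ω') ∂P) x)
              (scaledClip T (∫ ω', clip T (ξ (i - K) ω') ∂P) y)
            calc _ ≤ 2 * (1 / 2 * |x - y|) :=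
                  mul_le_mul (by linarith) h1 (abs_nonneg _) (by norm_num)
              _ = _ := by ring)
        (fun x => by rw [abs_mul]; exact mul_le_one₀ (hb _ _) (abs_nonneg _) (hb _ _))
        (by
          have := (measurable_scaledClip T (∫ ω', clip T (ξ (i - K) ω') ∂P)).comp
            (measurable_pi_apply (X := fun _ : Fin 1 => ℝ) 0)
          exact this.mul this) hZ hZ1
      refine this.trans ?_
      have := hg0' (i - p)
      push_cast at this ⊢
      linarith
    · have := key one_le_two (p := p - 1 - K) (d := i - p)
        (j := ![(i : ℤ) - K, (k : ℤ) - K])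
        (f := fun x => scaledClip T (∫ ω', clip T (ξ (i - K) ω') ∂P) (x 0)
          * scaledClip T (∫ ω', clip T (ξ (k - K) ω') ∂P) (x 1))
        (by
          rw [Fin.strictMono_iff_lt_succ]
          intro q
          fin_cases q
          simpa using hik)
        (by
          intro q
          fin_cases q
          · simp; omega
          · simp; omega)
        (isLip1_mul (hlip _) (hlip _) (hb _) (hb _))
        (fun x => by rw [abs_mul]; exact mul_le_one₀ (hb _ _) (abs_nonneg _) (hb _ _))
        (((measurable_scaledClip _ _).comp (measurable_pi_apply 0)).mul
          ((measurable_scaledClip _ _).comp (measurable_pi_apply 1))) hZ hZ1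
      refine (le_of_eq ?_).trans (this.trans ?_)
      · rfl
      have := hg0' (i - p)
      push_cast at this ⊢
      linarith

end Sequence

/-! ### The truncation residual -/

theorem exists_forall_integral_sub_clip_sq_le {P : Measure Ω} {ξ : ℤ → Ω → ℝ}
    (hL2 : ∀ i, MemLp (ξ i) 2 P) (hUI : UniformIntegrable (fun (i : ℤ) (ω : Ω) => ξ i ω ^ 2) 1 P)
    {η : ℝ} (hη : 0 < η) :
    ∃ T, 1 ≤ T ∧ ∀ i, ∫ ω, (ξ i ω - clip T (ξ i ω)) ^ 2 ∂P ≤ η := by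
  obtain ⟨C, hC⟩ := hUI.spec one_ne_zero ENNReal.one_ne_top hη
  refine ⟨max 1 C, le_max_left _ _, fun i => ?_⟩
  set T : ℝ := max 1 C
  have hT1 : 1 ≤ T := le_max_left _ _
  have hTC : (C : ℝ) ≤ T := le_max_right _ _
  set f : Ω → ℝ := fun ω => if (C : ℝ) ≤ ξ i ω ^ 2 then ξ i ω ^ 2 else 0 with hf
  have hfe : {ω | C ≤ ‖ξ i ω ^ 2‖₊}.indicator (fun ω => ξ i ω ^ 2) = f := by
    ext ω
    have : C ≤ ‖ξ i ω ^ 2‖₊ ↔ (C : ℝ) ≤ ξ i ω ^ 2 := by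
      rw [← NNReal.coe_le_coe, coe_nnnorm, Real.norm_of_nonneg (sq_nonneg _)]
    simp only [Set.indicator, Set.mem_ofPred_eq, this, hf]
  have hCi := hC i
  rw [hfe] at hCi
  have hf0 : ∀ ω, 0 ≤ f ω := fun ω => by
    simp only [hf]
    split_ifs <;> positivity
  have hsq : Integrable (fun ω => ξ i ω ^ 2) P := (hL2 i).integrable_sq
  have hfm : AEStronglyMeasurable f P := by
    rw [← hfe]
    refine hsq.aestronglyMeasurable.indicator₀ ?_
    exact nullMeasurableSet_le aemeasurable_const hsq.aemeasurable.nnnorm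
  have hfi : Integrable f P := hsq.mono hfm (.of_forall fun ω => by
    rw [Real.norm_of_nonneg (hf0 ω), Real.norm_of_nonneg (sq_nonneg _)]
    simp only [hf]
    split_ifs
    exacts [le_rfl, sq_nonneg _])
  have hle : ∀ ω, (ξ i ω - clip T (ξ i ω)) ^ 2 ≤ f ω := fun ω => by
    by_cases h : |ξ i ω| ≤ T
    · rw [clip_of_abs_le h]
      simpa using hf0 ω
    · have h1 : (C : ℝ) ≤ ξ i ω ^ 2 := by
        rw [← sq_abs]
        nlinarith
      simp only [hf, if_pos h1]
      rw [sq_le_sq]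
      exact abs_sub_clip_le (by linarith) _
  have h1 : ∫ ω, f ω ∂P ≤ η := by
    rw [eLpNorm_one_eq_lintegral_enorm, ← ofReal_integral_norm_eq_lintegral_enorm hfi,
      ENNReal.ofReal_le_ofReal_iff hη.le] at hCi
    simpa only [Real.norm_of_nonneg (hf0 _)] using hCi
  exact (integral_mono_of_nonneg (.of_forall fun ω => sq_nonneg _) hfi (.of_forall hle)).trans h1

/-- Comparing `x^(3/2) g(x)` with its value at `1` gives `g(n) ≤ g(1) n^(-3/2)`. -/
theorem summable_of_antitoneOn_rpow_mul {g : ℝ → ℝ} (hg0 : ∀ x, 0 < x → 0 ≤ g x)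
    (hganti : AntitoneOn (fun x : ℝ => x ^ (3 / 2 : ℝ) * g x) (Set.Ioi 0)) :
    Summable fun d : ℕ => g ((d + 1 : ℕ) : ℝ) := by
  have hs : Summable fun d : ℕ => g 1 * (1 / ((d + 1 : ℕ) : ℝ) ^ (3 / 2 : ℝ)) :=
    ((summable_nat_add_iff 1).2 (Real.summable_one_div_nat_rpow.2 (by norm_num))).mul_left _
  refine hs.of_nonneg_of_le (fun d => hg0 _ (by positivity)) fun d => ?_
  have hd : (1 : ℝ) ≤ ((d + 1 : ℕ) : ℝ) := by exact_mod_cast Nat.le_add_left 1 d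
  have h := hganti (Set.mem_Ioi.2 one_pos) (Set.mem_Ioi.2 (one_pos.trans_le hd)) hd
  simp only [Real.one_rpow, one_mul] at h
  rw [mul_one_div, le_div_iff₀ (by positivity), mul_comm]
  exact h

/-- The earlier residual is a past-measurable test variable of `L²` norm at most `r`, and the later
one is a centred Lipschitz function of `ξ`. Their covariance is thus at most `r g(lag)`, and the
variance bound tends to zero with `r`. -/
theorem integral_partialSum_residual_sq_le {P : Measure Ω} [IsProbabilityMeasure P]
    {ξ : ℤ → Ω → ℝ} (hmeas : ∀ i, Measurable (ξ i)) (hL2 : ∀ i, MemLp (ξ i) 2 P)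
    {g : ℝ → ℝ} (hg0 : ∀ x, 0 < x → 0 ≤ g x)
    (hgbound : ∀ n : ℕ, 1 ≤ n → theta2 P (past ξ) ξ n ≤ ENNReal.ofReal (g (n : ℝ)))
    {G : ℝ} (hG : ∀ n, ∑ d ∈ Finset.range n, g ((d + 1 : ℕ) : ℝ) ≤ G)
    {T r : ℝ} (hT : 0 ≤ T) (hr : 0 ≤ r)
    (hTr : ∀ i, ∫ ω, (ξ i ω - clip T (ξ i ω)) ^ 2 ∂P ≤ r ^ 2) (K : ℤ) (b : ℕ → ℝ) (N : ℕ) :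
    ∫ ω, partialSum b (fun (j : ℕ) ω => ξ (j - K) ω - clip T (ξ (j - K) ω)
        - ∫ ω', (ξ (j - K) ω' - clip T (ξ (j - K) ω')) ∂P) N ω ^ 2 ∂P
      ≤ (r ^ 2 + 2 * (r * G)) * ∑ i ∈ Finset.range N, b i ^ 2 := by
  have hψ : ∀ i, MemLp (fun ω => ξ i ω - clip T (ξ i ω)) 2 P := fun i => (hL2 i).mono
    ((hmeas i).sub ((measurable_clip T).comp (hmeas i))).aestronglyMeasurable
    (.of_forall fun ω => abs_sub_clip_le hT _)
  have hg0' : ∀ d : ℕ, 0 ≤ g ((d + 1 : ℕ) : ℝ) := fun d => hg0 _ (by positivity)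
  set V : ℤ → Ω → ℝ := fun i ω => ξ i ω - clip T (ξ i ω)
    - ∫ ω', (ξ i ω' - clip T (ξ i ω')) ∂P with hV
  have hVL : ∀ i, MemLp (V i) 2 P := fun i => (hψ i).sub (memLp_const _)
  have hVm : ∀ i, Measurable[past ξ i] (V i) := fun i =>
    ((measurable_past ξ i).sub ((measurable_clip T).comp (measurable_past ξ i))).sub_const _
  have hVr : ∀ i, ∫ ω, V i ω ^ 2 ∂P ≤ r ^ 2 := fun i => by
    have h1 := variance_le_expectation_sq (hψ i).1
    rw [variance_eq_integral (hψ i).1.aemeasurable] at h1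
    exact h1.trans (hTr i)
  have hint : ∀ i k, Integrable (fun ω => V i ω * V k ω) P := fun i k =>
    (hVL i).integrable_mul (hVL k)
  change ∫ ω, partialSum b (fun (j : ℕ) ω => V (j - K) ω) N ω ^ 2 ∂P ≤ _
  rw [integral_partialSum_sq (Y := fun (j : ℕ) ω => V (j - K) ω) (fun i k => hint _ _)]
  refine (Finset.sum_le_sum fun k _ => le_abs_self _).trans ?_
  refine sum_abs_varIncr_le (w := fun d => r * g ((d + 1 : ℕ) : ℝ))
    (fun d => mul_nonneg hr (hg0' d)) (fun k => ?_) (fun i k hik => ?_) (fun n => ?_) b N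
  · rw [abs_of_nonneg (integral_nonneg fun ω => mul_self_nonneg _)]
    simpa only [sq] using hVr (k - K)
  · have h := abs_integral_mul_sub_le hmeas (hg0' (k - 1 - i)) (hgbound _ (by omega)) le_rfl
      (p := i - K) (j := fun _ : Fin 1 => (k : ℤ) - K) (Subsingleton.strictMono _)
      (fun _ => by omega) (isLip1_comp_apply 0 (abs_sub_clip_sub_le hT)) (hψ (k - K))
      (hVm (i - K)) (hVL _)
    refine h.trans ?_
    rw [Nat.cast_one, one_mul]
    refine mul_le_mul_of_nonneg_right ?_ (hg0' _)
    exact (Real.sqrt_le_sqrt (hVr _)).trans_eq (Real.sqrt_sq hr)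
  · rw [← Finset.mul_sum]
    exact mul_le_mul_of_nonneg_left (hG n) hr

/-! ### Comparison with the Gaussian characteristic function -/

theorem norm_exp_I_mul_sub_exp_I_mul_le (x y : ℝ) :
    ‖Complex.exp (Complex.I * x) - Complex.exp (Complex.I * y)‖ ≤ |x - y| := by
  have e : Complex.exp (Complex.I * x) - Complex.exp (Complex.I * y)
      = Complex.exp (Complex.I * y) * (Complex.exp (Complex.I * (x - y : ℝ)) - 1) := by
    rw [mul_sub_one, ← Complex.exp_add]
    push_cast
    ring_nf
  rw [e, norm_mul, Complex.norm_exp_I_mul_ofReal, one_mul]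
  exact Real.norm_exp_I_mul_ofReal_sub_one_le

theorem abs_exp_neg_sub_exp_neg_le {a b : ℝ} (ha : 0 ≤ a) (hb : 0 ≤ b) :
    |Real.exp (-a) - Real.exp (-b)| ≤ |a - b| := by
  wlog hab : a ≤ b generalizing a b
  · rw [abs_sub_comm, abs_sub_comm a]
    exact this hb ha (le_of_not_ge hab)
  have h1 : Real.exp (-b) ≤ Real.exp (-a) := Real.exp_le_exp.2 (by linarith)
  have h2 : Real.exp (-a) ≤ 1 := Real.exp_le_one_iff.2 (by linarith)
  have h3 : Real.exp (-b) = Real.exp (-a) * Real.exp (-(b - a)) := by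
    rw [← Real.exp_add]
    ring_nf
  have h4 := Real.add_one_le_exp (-(b - a))
  rw [abs_of_nonneg (by linarith), abs_sub_comm, abs_of_nonneg (by linarith), h3]
  nlinarith [Real.exp_pos (-a)]

/-- An `L²` error `ρ` moves the characteristic function by at most `|t| ρ` and the second moment by
at most `2 ρ + ρ²`; hence `X` may be replaced by its truncated version `U`. -/
theorem norm_integral_exp_sub_gaussian_le {P : Measure Ω} [IsProbabilityMeasure P]
    {X U : Ω → ℝ} (hX : Measurable X) (hU : Measurable U) (hXL : MemLp X 2 P)
    (hUL : MemLp U 2 P) (hX1 : ∫ ω, X ω ^ 2 ∂P = 1) {ρ : ℝ} (hρ : 0 ≤ ρ)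
    (hXU : ∫ ω, (X ω - U ω) ^ 2 ∂P ≤ ρ ^ 2) (t : ℝ) :
    ‖∫ ω, Complex.exp (Complex.I * (t * X ω : ℝ)) ∂P - (Real.exp (-(t ^ 2 / 2)) : ℂ)‖
      ≤ ‖∫ ω, Complex.exp (Complex.I * (t * U ω : ℝ)) ∂P
          - (Real.exp (-(t ^ 2 * (∫ ω, U ω ^ 2 ∂P) / 2)) : ℂ)‖
        + |t| * ρ + t ^ 2 / 2 * (2 * ρ + ρ ^ 2) := by
  have hDL : MemLp (fun ω => X ω - U ω) 2 P := hXL.sub hUL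
  have hDA : MemLp (fun ω => |X ω - U ω|) 2 P := hDL.abs
  have hs : √(∫ ω, (X ω - U ω) ^ 2 ∂P) ≤ ρ :=
    (Real.sqrt_le_sqrt hXU).trans_eq (Real.sqrt_sq hρ)
  have hD1 : ∫ ω, |X ω - U ω| ∂P ≤ ρ := by
    have h := abs_integral_mul_le_sqrt_mul_sqrt hDA (memLp_const (1 : ℝ) (μ := P))
    simp only [mul_one, sq_abs, one_pow, integral_const, probReal_univ, smul_eq_mul,
      Real.sqrt_one] at h
    exact (le_abs_self _).trans (h.trans hs)
  have hXD : |∫ ω, X ω * (X ω - U ω) ∂P| ≤ ρ := by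
    refine (abs_integral_mul_le_sqrt_mul_sqrt hXL hDL).trans ?_
    rw [hX1, Real.sqrt_one, one_mul]
    exact hs
  have hu : |1 - ∫ ω, U ω ^ 2 ∂P| ≤ 2 * ρ + ρ ^ 2 := by
    have e : ∫ ω, U ω ^ 2 ∂P = 1 - 2 * (∫ ω, X ω * (X ω - U ω) ∂P)
        + ∫ ω, (X ω - U ω) ^ 2 ∂P := by
      have hi : Integrable (fun ω => X ω * (X ω - U ω)) P := hXL.integrable_mul hDL
      rw [← hX1, ← integral_const_mul, ← integral_sub hXL.integrable_sq (hi.const_mul 2)]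
      have := integral_add (hXL.integrable_sq.sub (hi.const_mul 2)) hDL.integrable_sq
      simp only [Pi.sub_apply] at this
      rw [← this]
      congr 1
      ext ω
      ring
    have h0 : 0 ≤ ∫ ω, (X ω - U ω) ^ 2 ∂P := integral_nonneg fun ω => sq_nonneg _
    rw [e, abs_le]
    constructor <;> linarith [abs_le.1 hXD]
  have hint : ∀ {f : Ω → ℝ}, Measurable f →
      Integrable (fun ω => Complex.exp (Complex.I * (t * f ω : ℝ))) P := fun hf =>
    integrable_of_norm_le (Complex.measurable_exp.comp
      ((Complex.measurable_ofReal.comp (hf.const_mul t)).const_mul _))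
      fun ω => (Complex.norm_exp_I_mul_ofReal _).le
  have h1 : ‖∫ ω, Complex.exp (Complex.I * (t * X ω : ℝ)) ∂P
      - ∫ ω, Complex.exp (Complex.I * (t * U ω : ℝ)) ∂P‖ ≤ |t| * ρ := by
    rw [← integral_sub (hint hX) (hint hU)]
    refine (norm_integral_le_integral_norm _).trans ?_
    have h2 : ∫ ω, |t| * |X ω - U ω| ∂P ≤ |t| * ρ := by
      rw [integral_const_mul]
      gcongr
    refine le_trans (integral_mono ((hint hX).sub (hint hU)).norm
      ((hDA.integrable (by norm_num)).const_mul _) fun ω => ?_) h2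
    refine (norm_exp_I_mul_sub_exp_I_mul_le _ _).trans_eq ?_
    rw [← mul_sub, abs_mul]
  have h2 : ‖(Real.exp (-(t ^ 2 * (∫ ω, U ω ^ 2 ∂P) / 2)) : ℂ) - (Real.exp (-(t ^ 2 / 2)) : ℂ)‖
      ≤ t ^ 2 / 2 * (2 * ρ + ρ ^ 2) := by
    have hu0 : 0 ≤ ∫ ω, U ω ^ 2 ∂P := integral_nonneg fun ω => sq_nonneg _
    rw [← Complex.ofReal_sub, Complex.norm_real, Real.norm_eq_abs]
    refine (abs_exp_neg_sub_exp_neg_le (by positivity) (by positivity)).trans ?_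
    have : t ^ 2 * (∫ ω, U ω ^ 2 ∂P) / 2 - t ^ 2 / 2 = -(t ^ 2 / 2 * (1 - ∫ ω, U ω ^ 2 ∂P)) := by
      ring
    rw [this, abs_neg, abs_mul, abs_of_nonneg (by positivity : 0 ≤ t ^ 2 / 2)]
    gcongr
  have h3 := norm_sub_le_norm_sub_add_norm_sub
    (∫ ω, Complex.exp (Complex.I * (t * X ω : ℝ)) ∂P)
    (∫ ω, Complex.exp (Complex.I * (t * U ω : ℝ)) ∂P) (Real.exp (-(t ^ 2 / 2)) : ℂ)
  have h4 := norm_sub_le_norm_sub_add_norm_sub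
    (∫ ω, Complex.exp (Complex.I * (t * U ω : ℝ)) ∂P)
    (Real.exp (-(t ^ 2 * (∫ ω, U ω ^ 2 ∂P) / 2)) : ℂ) (Real.exp (-(t ^ 2 / 2)) : ℂ)
  linarith

theorem sum_Icc_neg_eq_sum_range {M : Type*} [AddCommMonoid M] (K : ℕ) (f : ℤ → M) :
    ∑ i ∈ Finset.Icc (-(K : ℤ)) (K : ℤ), f i
      = ∑ j ∈ Finset.range (2 * K + 1), f ((j : ℤ) - (K : ℤ)) := by
  refine Finset.sum_nbij' (fun i => (i + K).toNat) (fun j => (j : ℤ) - K) ?_ ?_ ?_ ?_ ?_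
  · intro i hi
    simp only [Finset.mem_Icc, Finset.mem_range] at hi ⊢
    omega
  · intro j hj
    simp only [Finset.mem_Icc, Finset.mem_range] at hj ⊢
    omega
  · intro i hi
    simp only [Finset.mem_Icc] at hi
    omega
  · intro j _
    simp
  · intro i hi
    simp only [Finset.mem_Icc] at hi
    congr 1
    omega

theorem exists_delta_norm_integral_exp_sub_gaussian_le {P : Measure Ω} [IsProbabilityMeasure P]
    {ξ : ℤ → Ω → ℝ} (hmeas : ∀ i, Measurable (ξ i)) (hL2 : ∀ i, MemLp (ξ i) 2 P)
    (hcent : ∀ i, ∫ ω, ξ i ω ∂P = 0)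
    (hUI : UniformIntegrable (fun (i : ℤ) (ω : Ω) => ξ i ω ^ 2) 1 P)
    {g : ℝ → ℝ} (hg0 : ∀ x, 0 < x → 0 ≤ g x)
    (hgbound : ∀ n : ℕ, 1 ≤ n → theta2 P (past ξ) ξ n ≤ ENNReal.ofReal (g (n : ℝ)))
    (hgs : Summable fun d : ℕ => g ((d + 1 : ℕ) : ℝ)) (t C : ℝ) {ε : ℝ} (hε : 0 < ε) :
    ∃ δ > 0, ∀ (K : ℕ) (α : ℤ → ℝ), (∀ i ∈ Finset.Icc (-(K : ℤ)) (K : ℤ), |α i| ≤ δ) →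
      ∑ i ∈ Finset.Icc (-(K : ℤ)) (K : ℤ), α i ^ 2 ≤ C →
      ∫ ω, (∑ i ∈ Finset.Icc (-(K : ℤ)) (K : ℤ), α i * ξ i ω) ^ 2 ∂P = 1 →
      ‖∫ ω, Complex.exp (Complex.I
          * (t * ∑ i ∈ Finset.Icc (-(K : ℤ)) (K : ℤ), α i * ξ i ω : ℝ)) ∂P
        - (Real.exp (-(t ^ 2 / 2)) : ℂ)‖ ≤ ε := by
  have hg0' : ∀ d : ℕ, 0 ≤ g ((d + 1 : ℕ) : ℝ) := fun d => hg0 _ (by positivity)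
  set G := ∑' d : ℕ, g ((d + 1 : ℕ) : ℝ)
  have hG : ∀ n, ∑ d ∈ Finset.range n, g ((d + 1 : ℕ) : ℝ) ≤ G :=
    fun n => hgs.sum_le_tsum _ fun _ _ => hg0' _
  have hG0 : 0 ≤ G := tsum_nonneg hg0'
  -- `ρ` bounds the `L²` error of truncating the sum, `r` that of truncating one variable; `r` fixes
  -- `T`, and only then is `δ` chosen.
  obtain ⟨ρ, hρε, hρ0 : 0 < ρ⟩ : ∃ ρ : ℝ, |t| * ρ + t ^ 2 / 2 * (2 * ρ + ρ ^ 2) < ε / 2 ∧ 0 < ρ := by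
    have h : Continuous fun ρ : ℝ => |t| * ρ + t ^ 2 / 2 * (2 * ρ + ρ ^ 2) := by fun_prop
    have h2 := (h.tendsto 0).mono_left (nhdsWithin_le_nhds (s := Set.Ioi 0))
    exact ((h2.eventually (gt_mem_nhds (by simpa using half_pos hε))).and
      self_mem_nhdsWithin).exists
  obtain ⟨r, hrρ, hr0 : 0 < r⟩ : ∃ r : ℝ, (r ^ 2 + 2 * (r * G)) * C < ρ ^ 2 ∧ 0 < r := by
    have h : Continuous fun r : ℝ => (r ^ 2 + 2 * (r * G)) * C := by fun_prop
    have h2 := (h.tendsto 0).mono_left (nhdsWithin_le_nhds (s := Set.Ioi 0))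
    exact ((h2.eventually (gt_mem_nhds (by simpa using pow_pos hρ0 2))).and
      self_mem_nhdsWithin).exists
  obtain ⟨T, hT1, hT⟩ := exists_forall_integral_sub_clip_sq_le hL2 hUI (pow_pos hr0 2)
  have hT0 : 0 < T := by linarith
  obtain ⟨δ, hδ0, hδ⟩ := exists_delta_norm_integral_expSum_sub_exp_le (Ω := Ω)
    (θ := fun d : ℕ => 4 * g ((d + 1 : ℕ) : ℝ))
    (fun d => mul_nonneg (by norm_num) (hg0' d)) (hgs.mul_left 4) ((2 * T * t) ^ 2 * C)
    (half_pos hε)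
  -- Undoing the scaling by `2 T` turns the weights of `t U` into `2 T t β_j`; `|t| + 1` keeps the
  -- quotient meaningful at `t = 0`.
  refine ⟨δ / (2 * T * (|t| + 1)), by positivity, fun K α hα hαC hα1 => ?_⟩
  set N := 2 * K + 1
  -- The weights are extended by zero because smallness is required at every index.
  set β : ℕ → ℝ := fun j => if j < N then α ((j : ℤ) - K) else 0 with hβ
  have hβα : ∀ j ∈ Finset.range N, β j = α ((j : ℤ) - K) := fun j hj =>
    if_pos (Finset.mem_range.1 hj)
  have hβb : ∀ j, |2 * T * t * β j| ≤ δ := fun j => by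
    have h1 : |β j| ≤ δ / (2 * T * (|t| + 1)) := by
      simp only [hβ]
      split_ifs with h
      · exact hα _ (by rw [Finset.mem_Icc]; omega)
      · rw [abs_zero]
        positivity
    rw [le_div_iff₀ (by positivity)] at h1
    rw [abs_mul, abs_mul, abs_of_pos (by positivity : 0 < 2 * T)]
    nlinarith [abs_nonneg (β j)]
  have hβC : ∑ j ∈ Finset.range N, β j ^ 2 ≤ C := by
    rw [sum_Icc_neg_eq_sum_range] at hαC
    rwa [Finset.sum_congr rfl fun j hj => by rw [hβα j hj]]
  have hXe : ∀ ω, ∑ i ∈ Finset.Icc (-(K : ℤ)) (K : ℤ), α i * ξ i ω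
      = partialSum β (fun (j : ℕ) ω => ξ (j - K) ω) N ω := fun ω => by
    rw [sum_Icc_neg_eq_sum_range, partialSum]
    exact Finset.sum_congr rfl fun j hj => by rw [hβα j hj]
  set c : ℤ → ℝ := fun i => ∫ ω, clip T (ξ i ω) ∂P with hc
  set X := partialSum β (fun (j : ℕ) ω => ξ (j - K) ω) N with hX
  set U := partialSum β (fun (j : ℕ) ω => clip T (ξ (j - K) ω) - c (j - K)) N with hU
  have hcm : ∀ i, Measurable fun ω => clip T (ξ i ω) - c i :=
    fun i => ((measurable_clip T).comp (hmeas i)).sub_const _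
  have hcL : ∀ i, MemLp (fun ω => clip T (ξ i ω) - c i) 2 P := fun i =>
    (MemLp.of_bound ((measurable_clip T).comp (hmeas i)).aestronglyMeasurable T
      (.of_forall fun ω => abs_clip_le hT0.le _)).sub (memLp_const _)
  have hXm : Measurable X := Finset.measurable_fun_sum _ fun i _ => (hmeas _).const_mul _
  have hUm : Measurable U := Finset.measurable_fun_sum _ fun i _ => (hcm _).const_mul _
  have hXL : MemLp X 2 P := memLp_finsetSum _ fun i _ => (hL2 _).const_mul _
  have hUL : MemLp U 2 P := memLp_finsetSum _ fun i _ => (hcL _).const_mul _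
  have hXU : ∫ ω, (X ω - U ω) ^ 2 ∂P ≤ ρ ^ 2 := by
    have h := integral_partialSum_residual_sq_le hmeas hL2 hg0 hgbound hG hT0.le hr0.le hT K β N
    have e : ∀ ω, X ω - U ω = partialSum β (fun (j : ℕ) ω => ξ (j - K) ω - clip T (ξ (j - K) ω)
        - ∫ ω', (ξ (j - K) ω' - clip T (ξ (j - K) ω')) ∂P) N ω := fun ω => by
      simp only [hX, hU, partialSum]
      rw [← Finset.sum_sub_distrib]
      refine Finset.sum_congr rfl fun j _ => ?_
      rw [integral_sub ((hL2 _).integrable (by norm_num)) (integrable_clip hmeas hT0.le _), hcent]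
      ring
    simp_rw [e]
    refine h.trans (le_trans ?_ hrρ.le)
    gcongr
  simp_rw [hXe] at hα1 ⊢
  refine (norm_integral_exp_sub_gaussian_le hXm hUm hXL hUL hα1 hρ0.le hXU t).trans ?_
  have hkey := hδ P _ _ (causalWeakDep_scaledClip hmeas hg0 hgbound hT1 K)
    (fun j => 2 * T * t * β j) N hβb (by
      simp only [mul_pow _ (β _), ← Finset.mul_sum]
      gcongr)
  have hpU : ∀ ω, partialSum (fun j => 2 * T * t * β j) (fun (j : ℕ) ω =>
      scaledClip T (∫ ω', clip T (ξ (j - K) ω') ∂P) (ξ (j - K) ω)) N ω = t * U ω := fun ω => by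
    simp only [hU, partialSum, scaledClip, hc]
    rw [Finset.mul_sum]
    refine Finset.sum_congr rfl fun j _ => ?_
    field_simp
  simp_rw [expSum, hpU, mul_pow, integral_const_mul] at hkey
  linarith

end WeakDep

/-! ### Conclusion by Lévy's continuity theorem -/

theorem theorem3p1 {Ω : Type*} [MeasurableSpace Ω] (P : Measure Ω) [IsProbabilityMeasure P]
    -- centered, non essentially constant, square integrable random variables
    (ξ : ℤ → Ω → ℝ) (hmeas : ∀ i, Measurable (ξ i)) (hL2 : ∀ i, MemLp (ξ i) 2 P)
    (hcent : ∀ i, ∫ ω, ξ i ω ∂P = 0) (hnonconst : ∀ i, ¬ ∃ c : ℝ, ∀ᵐ ω ∂P, ξ i ω = c)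
    -- the triangular array of coefficients
    (k : ℕ → ℕ) (hkpos : ∀ n, 1 ≤ n → 0 < k n) (hkmono : MonotoneOn k (Set.Ici 1))
    (hklim : Tendsto k atTop atTop)
    (a : ℕ → ℤ → ℝ)
    (ha : ∀ n, 0 < ∑ i ∈ Finset.Icc (-(k n : ℤ)) (k n : ℤ), a n i ^ 2)
    -- (A1)
    (hA1i : 0 < liminf (fun n : ℕ =>
      ((variance (WeakDep.rowSum k a ξ n) P /
        ∑ i ∈ Finset.Icc (-(k n : ℤ)) (k n : ℤ), a n i ^ 2 : ℝ) : EReal)) atTop)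
    (hA1ii : Tendsto (fun n : ℕ => (WeakDep.rowSD P k a ξ n)⁻¹ * WeakDep.rowMax k a n)
      atTop (𝓝 0))
    -- (A2)
    (hA2 : UniformIntegrable (fun (i : ℤ) (ω : Ω) => ξ i ω ^ 2) 1 P)
    -- (A3)
    (g : ℝ → ℝ) (hg0 : ∀ x, 0 < x → 0 ≤ g x)
    (hgbound : ∀ n : ℕ, 1 ≤ n →
      WeakDep.theta2 P (WeakDep.past ξ) ξ n ≤ ENNReal.ofReal (g (n : ℝ)))
    (hganti : AntitoneOn (fun x : ℝ => x ^ (3 / 2 : ℝ) * g x) (Set.Ioi 0))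
    (hgsum : ∃ ε : ℝ, 0 < ε ∧ ε < 1 ∧
      Summable (fun i : ℕ => (2 : ℝ) ^ (3 * (i : ℝ) / 2) * g ((2 : ℝ) ^ ((i : ℝ) * ε)))) :
    TendstoInDistribution
      (fun (n : ℕ) (ω : Ω) => WeakDep.rowSum k a ξ n ω / WeakDep.rowSD P k a ξ n)
      atTop (id : ℝ → ℝ) (fun _ => P) (gaussianReal 0 1) := by
  have hrm : ∀ n, Measurable (WeakDep.rowSum k a ξ n) := fun n =>
    Finset.measurable_fun_sum _ fun i _ => (hmeas _).const_mul _
  have hrL : ∀ n, MemLp (WeakDep.rowSum k a ξ n) 2 P := fun n =>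
    memLp_finsetSum _ fun i _ => (hL2 _).const_mul _
  have hr0 : ∀ n, ∫ ω, WeakDep.rowSum k a ξ n ω ∂P = 0 := fun n => by
    unfold WeakDep.rowSum
    rw [integral_finsetSum _ fun i _ => ((hL2 i).integrable (by norm_num)).const_mul _]
    simp [integral_const_mul, hcent]
  have hgs := WeakDep.summable_of_antitoneOn_rpow_mul hg0 hganti
  -- A real `c` strictly between `0` and the lower limit: eventually `σ_n² > c ∑ a_{n,i}²`, so `σ_n
  -- > 0` and the normalised weights have sum of squares at most `c⁻¹`.
  obtain ⟨c, hc0, hc⟩ := EReal.lt_iff_exists_real_btwn.1 hA1i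
  rw [EReal.coe_pos] at hc0
  have hev := eventually_lt_of_lt_liminf hc
  refine ⟨fun n => ((hrm n).div_const _).aemeasurable, aemeasurable_id, ?_⟩
  refine ProbabilityMeasure.tendsto_iff_tendsto_charFun.2 fun t => ?_
  change Tendsto (fun n => charFun (P.map fun ω => WeakDep.rowSum k a ξ n ω
    / WeakDep.rowSD P k a ξ n) t) atTop (𝓝 (charFun ((gaussianReal 0 1).map id) t))
  have hlim : charFun ((gaussianReal 0 1).map id) t = (Real.exp (-(t ^ 2 / 2)) : ℂ) := by
    rw [Measure.map_id, charFun_gaussianReal]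
    push_cast
    congr 1
    simp
  rw [hlim, Metric.tendsto_nhds]
  intro ε hε
  obtain ⟨δ, hδ0, hδ⟩ := WeakDep.exists_delta_norm_integral_exp_sub_gaussian_le hmeas hL2 hcent
    hA2 hg0 hgbound hgs t c⁻¹ (half_pos hε)
  filter_upwards [hev, hA1ii.eventually (gt_mem_nhds hδ0)] with n hn1 hn2
  rw [EReal.coe_lt_coe_iff, lt_div_iff₀ (ha n)] at hn1
  set σ := WeakDep.rowSD P k a ξ n with hσ
  have hσ2 : σ ^ 2 = variance (WeakDep.rowSum k a ξ n) P := Real.sq_sqrt (variance_nonneg _ _)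
  have hvar : variance (WeakDep.rowSum k a ξ n) P = ∫ ω, WeakDep.rowSum k a ξ n ω ^ 2 ∂P :=
    variance_of_integral_eq_zero (hrm n).aemeasurable (hr0 n)
  have hσ0 : 0 < σ := by
    refine Real.sqrt_pos.2 ((mul_pos hc0 (ha n)).trans hn1)
  have hsum : ∀ ω, ∑ i ∈ Finset.Icc (-(k n : ℤ)) (k n : ℤ), a n i / σ * ξ i ω
      = WeakDep.rowSum k a ξ n ω / σ := fun ω => by
    rw [WeakDep.rowSum, Finset.sum_div]
    exact Finset.sum_congr rfl fun i _ => by ring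
  have h := hδ (k n) (fun i => a n i / σ) (fun i hi => ?_) ?_ ?_
  · rw [charFun_apply_real, integral_map ((hrm n).div_const _).aemeasurable (by fun_prop)]
    rw [dist_eq_norm]
    refine lt_of_le_of_lt (le_trans (le_of_eq ?_) h) (half_lt_self hε)
    congr 2
    refine integral_congr_ae (.of_forall fun ω => ?_)
    simp only [hsum]
    push_cast
    congr 1
    ring
  · rw [abs_div, abs_of_pos hσ0, div_eq_inv_mul]
    refine le_trans ?_ hn2.le
    gcongr
    exact Finset.le_sup' (fun i => |a n i|) hi
  · simp only [div_pow, ← Finset.sum_div]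
    rw [hσ2, div_le_iff₀ ((mul_pos hc0 (ha n)).trans hn1), inv_mul_eq_div, le_div_iff₀ hc0,
      mul_comm]
    exact hn1.le
  · simp only [hsum, div_pow]
    rw [integral_div, ← hvar, ← hσ2, div_self (by positivity)]
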